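/- Let $S_0,S_1,S_2$ be closed (that is, compact and connected) Riemann surfaces and let $\beta_1:S_1\to S_0$, $\beta_2:S_2\to S_0$ be non-constant holomorphic maps. Let $$X=S_1\times_{(\beta_1,\beta_2)}S_2=\{(z_1,z_2)\in S_1\times S_2:\ \beta_1(z_1)=\beta_2(z_2)\}$$ be their fiber product, with the subspace topology, and assume that $X$ is connected. Let $\mathrm{ord}_{\beta_j}(z)$ be the local order (multiplicity) of $\beta_j$ at $z$, that is, the integer $n\ge 1$ such that $\beta_j$ is $t\mapsto t^n$ in suitable local coordinates centred at $z$ and $\beta_j(z)$, and for $j=1,2$ and $q\in S_0$ set $$a_q^{(j)}=\mathrm{lcm}\big(\mathrm{ord}_{\beta_j}(z):\ \beta_j(z)=q\big).$$ Suppose that at least one of the following holds: 1. $\gcd(\deg\beta_1,\deg\beta_2)=1$; 2. $\gcd(a_q^{(1)},a_q^{(2)})=1$ for every $q\in S_0$. Then $X$ is irreducible: there are one closed Riemann surface $R$ and a topological quotient map $\nu:R\to X$ with finite fibers, only finitely many of which have more than one point, such that the compositions $R\to S_1$ and $R\to S_2$ of $\nu$ with the two projections of $X$ are holomorphic. In other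 words, $X$ is obtained from the single closed Riemann surface $R$ by collapsing each of finitely many pairwise disjoint finite subsets to a point. Moreover, if (2) holds, then $X$ is itself a closed Riemann surface: the space $X$ carries a complex structure making it a closed Riemann surface for which both projections $X\to S_1$ and $X\to S_2$ are holomorphic. -/

import Mathlib

open scoped Manifold ContDiff

/-- A closed Riemann surface: a compact connected Hausdorff space with an atlas of charts
to `ℂ` whose transition maps are holomorphic (i.e. complex analytic). -/
class ClosedRiemannSurface (X : Type*) [TopologicalSpace X] [ChartedSpace ℂ X] : Prop
    extends T2Space X, CompactSpace X, ConnectedSpace X, IsManifold 𝓘(ℂ) ω X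

/-- The local order (multiplicity) `ord_β(z)`: the vanishing order at `z` of `β - β(z)`, read in
the charts at `z` and `β z`; it is the `n` for which `β` is `t ↦ t ^ n` in suitable local
coordinates centred at `z` and `β z`. -/
noncomputable def localOrder {S S₀ : Type*} [TopologicalSpace S] [ChartedSpace ℂ S]
    [TopologicalSpace S₀] [ChartedSpace ℂ S₀] (β : S → S₀) (z : S) : ℕ :=
  analyticOrderNatAt
    (fun t : ℂ => chartAt ℂ (β z) (β ((chartAt ℂ z).symm t)) - chartAt ℂ (β z) (β z))
    (chartAt ℂ z z)

/-- The number of points of the fiber of `β` over `q`, counted with multiplicity. -/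
noncomputable def fiberDegree {S S₀ : Type*} [TopologicalSpace S] [ChartedSpace ℂ S]
    [TopologicalSpace S₀] [ChartedSpace ℂ S₀] (β : S → S₀) (q : S₀) : ℕ :=
  ∑ᶠ z ∈ β ⁻¹' {q}, localOrder β z

/-- The degree of a non-constant holomorphic map between closed Riemann surfaces: the number of
points, with multiplicity, of a fiber. (It is classical that all fibers give the same number, so
the choice of the fiber is immaterial.) -/
noncomputable def mapDegree {S S₀ : Type*} [TopologicalSpace S] [ChartedSpace ℂ S]
    [TopologicalSpace S₀] [ChartedSpace ℂ S₀] [Nonempty S₀] (β : S → S₀) : ℕ :=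
  fiberDegree β (Classical.arbitrary S₀)

/-- The least common multiple of the local orders of `β` at the points of the fiber over `q`:
the least positive integer divisible by all of them. -/
noncomputable def fiberLcm {S S₀ : Type*} [TopologicalSpace S] [ChartedSpace ℂ S]
    [TopologicalSpace S₀] [ChartedSpace ℂ S₀] (β : S → S₀) (q : S₀) : ℕ :=
  sInf {m : ℕ | 0 < m ∧ ∀ z : S, β z = q → localOrder β z ∣ m}

section FiberProduct

variable {S₁ S₂ S₀ : Type*}
  [TopologicalSpace S₁] [ChartedSpace ℂ S₁] [TopologicalSpace S₂] [ChartedSpace ℂ S₂]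

/-- `ν : R → S₁ ×_(β₁, β₂) S₂` presents the fiber product as a singular Riemann surface with the
closed Riemann surface `R` as its only irreducible component: as a topological space the fiber
product is the quotient of `R` which identifies to a point each of finitely many, pairwise
disjoint, finite subsets of `R` (the fibers of `ν` with more than one point), and the complex
structures agree, in that both projections are holomorphic on `R`. -/
structure IsSingleComponent (β₁ : S₁ → S₀) (β₂ : S₂ → S₀)
    {R : Type*} [TopologicalSpace R] [ChartedSpace ℂ R]
    (ν : R → Function.Pullback β₁ β₂) : Prop where
  closedRiemannSurface : ClosedRiemannSurface R
  isQuotientMap : Topology.IsQuotientMap ν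
  finite_fiber : ∀ p, (ν ⁻¹' {p}).Finite
  finite_identified : {p | (ν ⁻¹' {p}).Nontrivial}.Finite
  holomorphic_fst : MDifferentiable 𝓘(ℂ) 𝓘(ℂ) (fun x => (ν x).fst)
  holomorphic_snd : MDifferentiable 𝓘(ℂ) 𝓘(ℂ) (fun x => (ν x).snd)

end FiberProduct

/-- The fiber product `S₁ ×_(β₁, β₂) S₂` is irreducible: it is a singular Riemann surface with
exactly one irreducible component. -/
def FiberProductIrreducible.{u, v, w} {S₁ : Type u} {S₂ : Type v} {S₀ : Type w}
    [TopologicalSpace S₁] [ChartedSpace ℂ S₁] [TopologicalSpace S₂] [ChartedSpace ℂ S₂]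
    (β₁ : S₁ → S₀) (β₂ : S₂ → S₀) : Prop :=
  ∃ (R : Type (max u v)) (_ : TopologicalSpace R) (_ : ChartedSpace ℂ R)
    (ν : R → Function.Pullback β₁ β₂), IsSingleComponent β₁ β₂ ν

/-- The fiber product, with its subspace topology from `S₁ × S₂`, is itself a closed Riemann
surface: it has a complex structure for which both projections are holomorphic. -/
def FiberProductIsClosedRiemannSurface {S₁ S₂ S₀ : Type*}
    [TopologicalSpace S₁] [ChartedSpace ℂ S₁] [TopologicalSpace S₂] [ChartedSpace ℂ S₂]
    (β₁ : S₁ → S₀) (β₂ : S₂ → S₀) : Prop :=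
  ∃ _ : ChartedSpace ℂ (Function.Pullback β₁ β₂),
    ClosedRiemannSurface (Function.Pullback β₁ β₂) ∧
    MDifferentiable 𝓘(ℂ) 𝓘(ℂ) (Function.Pullback.fst : Function.Pullback β₁ β₂ → S₁) ∧
    MDifferentiable 𝓘(ℂ) 𝓘(ℂ) (Function.Pullback.snd : Function.Pullback β₁ β₂ → S₂)

/-! Near a point where the local orders are m and n, power charts turn the fiber product X into the
plane curve t^m = s^n. Put g = gcd(m, n), a = n/g, b = m/g. The curve is a union of g branches
meeting only at the origin, one for each ξ with ξ^g = 1, and each is the injective image of a disc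
under u ↦ (u^a, c u^b), where c^a = ξ⁻¹. The pairs (point of X, root ξ), with these discs as charts,
form the normalization R (`BranchPoint`, `Normalization`). Discs with different centres overlap only
over points where both maps are unramified, and there the transition is a composition of
biholomorphisms (`exists_transition`). R is compact and Hausdorff, and R → X is a quotient map with
g points over each point, hence injective away from finitely many points (`compactSpace`,
`ncard_fiber`, `finite_identified`). What remains is the connectedness of R.

Under condition (2) every g is 1, so R → X is a continuous bijection from a compact space to a
Hausdorff one. It is a homeomorphism: connectedness passes from X to R, and the complex structure
passes from R to X.

Under condition (1) the argument counts degrees. A clopen C ⊆ R has a degree d over S₁ and a degree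
e over S₂, because weighted fiber counts of branched maps are locally constant
(`isLocallyConstant_finsum_fiber`, `IsBalancedAt.indicator`). Computing the degree of C over S₀
along both routes gives deg β₁ · d = deg β₂ · e, so deg β₂ divides d. All of R has degree deg β₂
over S₁ (`finsum_fstOrder`), so either C or its complement has degree 0 and is empty
(`preconnectedSpace_of_coprime`). -/

open scoped Topology

/-! ### Local normal forms in one complex variable. -/

/-- An analytic function vanishing to finite positive order `n` is locally the `n`-th power of a
function with simple zero. -/
theorem AnalyticAt.exists_eventually_eq_pow {f : ℂ → ℂ} {z₀ : ℂ} (hf : AnalyticAt ℂ f z₀) {n : ℕ}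
    (hn : n ≠ 0) (hord : analyticOrderAt f z₀ = n) :
    ∃ g : ℂ → ℂ, AnalyticAt ℂ g z₀ ∧ g z₀ = 0 ∧ deriv g z₀ ≠ 0 ∧ ∀ᶠ z in 𝓝 z₀, f z = g z ^ n := by
  obtain ⟨h, ha, h0, he⟩ := hf.analyticOrderAt_eq_natCast.1 hord
  -- Dividing by `h z₀` moves the argument of the root close to 1, inside the domain where the
  -- principal branch is analytic.
  let k : ℂ → ℂ := fun z => h z₀ ^ (n⁻¹ : ℂ) * (h z / h z₀) ^ (n⁻¹ : ℂ)
  have hk : AnalyticAt ℂ k z₀ := by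
    refine analyticAt_const.mul (AnalyticAt.cpow (ha.div analyticAt_const h0) analyticAt_const ?_)
    simp [h0]
  have hk0 : k z₀ ≠ 0 := by simp [k, h0]
  have hsub : AnalyticAt ℂ (fun z : ℂ => z - z₀) z₀ := analyticAt_id.sub analyticAt_const
  refine ⟨fun z => (z - z₀) * k z, hsub.mul hk, by simp, ?_, ?_⟩
  · have := ((hasDerivAt_id z₀).sub_const z₀).mul hk.differentiableAt.hasDerivAt
    have h2 := this.deriv
    simp only [id, sub_self, zero_mul, add_zero, one_mul] at h2
    change deriv ((fun z => z - z₀) * k) z₀ ≠ 0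
    rwa [h2]
  · filter_upwards [he] with z hz
    rw [hz, mul_pow, smul_eq_mul]
    congr 1
    simp only [k]
    rw [mul_pow, Complex.cpow_nat_inv_pow _ hn, Complex.cpow_nat_inv_pow _ hn]
    field_simp

/-- The holomorphic inverse function theorem, as a statement about open partial homeomorphisms. -/
theorem AnalyticAt.exists_openPartialHomeomorph {g : ℂ → ℂ} {z₀ : ℂ} (hg : AnalyticAt ℂ g z₀)
    (hd : deriv g z₀ ≠ 0) :
    ∃ G : OpenPartialHomeomorph ℂ ℂ, z₀ ∈ G.source ∧ (∀ z, G z = g z) ∧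
      G.MDifferentiable 𝓘(ℂ) 𝓘(ℂ) := by
  have hs : HasStrictDerivAt g (deriv g z₀) z₀ := hg.hasStrictDerivAt
  let G₀ := (hs.hasStrictFDerivAt_equiv hd).toOpenPartialHomeomorph g
  have hG₀ : ∀ z, G₀ z = g z := fun _ => rfl
  have hev : ∀ᶠ z in 𝓝 z₀, AnalyticAt ℂ g z ∧ deriv g z ≠ 0 :=
    hg.eventually_analyticAt.and (hg.deriv.continuousAt.eventually_ne hd)
  obtain ⟨O, hO, hOo, hzO⟩ := eventually_nhds_iff.1 hev
  let G := G₀.restrOpen O hOo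
  have hGs : ∀ z ∈ G.source, AnalyticAt ℂ g z ∧ deriv g z ≠ 0 := fun z hz => hO z hz.2
  refine ⟨G, ⟨(hs.hasStrictFDerivAt_equiv hd).mem_toOpenPartialHomeomorph_source, hzO⟩,
    hG₀, ?_, ?_⟩
  · rw [mdifferentiableOn_iff_differentiableOn]
    exact fun z hz => (hGs z hz).1.differentiableAt.differentiableWithinAt
  · rw [mdifferentiableOn_iff_differentiableOn]
    intro w hw
    have h1 := hGs _ (G.map_target hw)
    have h2 := G.hasDerivAt_symm hw h1.2 h1.1.differentiableAt.hasDerivAt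
    exact h2.differentiableAt.differentiableWithinAt

/-- An open partial homeomorphism can be shrunk to have a small disc as target. -/
theorem OpenPartialHomeomorph.exists_target_eq_ball {S : Type*} [TopologicalSpace S]
    [ChartedSpace ℂ S] (e : OpenPartialHomeomorph S ℂ) {z : S} (hz : z ∈ e.source)
    (h0 : e z = 0) (he : e.MDifferentiable 𝓘(ℂ) 𝓘(ℂ)) {O : Set S} (hO : O ∈ 𝓝 z) :
    ∃ (e' : OpenPartialHomeomorph S ℂ) (r : ℝ), 0 < r ∧ r ≤ 1 ∧ z ∈ e'.source ∧ (∀ y, e' y = e y) ∧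
      e'.target = Metric.ball 0 r ∧ e'.MDifferentiable 𝓘(ℂ) 𝓘(ℂ) ∧ e'.source ⊆ O := by
  let e₁ := e.restrOpen (interior O) isOpen_interior
  have hz₁ : z ∈ e₁.source := ⟨hz, mem_interior_iff_mem_nhds.2 hO⟩
  have ht : (0 : ℂ) ∈ e₁.target := by
    have := e₁.map_source hz₁
    rwa [show e₁ z = 0 from h0] at this
  obtain ⟨r, hr, hrt⟩ := Metric.isOpen_iff.1 e₁.open_target 0 ht
  -- Radius at most 1 ensures that powers of a small parameter stay in the disc (used in
  -- `norm_pow_lt`).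
  let r' := min r 1
  have hr' : 0 < r' := lt_min hr one_pos
  let B := OpenPartialHomeomorph.ofSet (Metric.ball (0 : ℂ) r') Metric.isOpen_ball
  have hd₁ : e₁.MDifferentiable 𝓘(ℂ) 𝓘(ℂ) :=
    ⟨he.1.mono Set.inter_subset_left, he.2.mono Set.inter_subset_left⟩
  have hB : B.MDifferentiable 𝓘(ℂ) 𝓘(ℂ) :=
    ⟨mdifferentiableOn_id, mdifferentiableOn_id⟩
  refine ⟨e₁.trans B, r', hr', min_le_right _ _, ?_, fun _ => rfl, ?_, hd₁.trans hB, ?_⟩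
  · refine ⟨hz₁, ?_⟩
    simp only [Set.mem_preimage]
    change e z ∈ Metric.ball 0 r'
    rw [h0]
    exact Metric.mem_ball_self hr'
  · rw [OpenPartialHomeomorph.trans_target]
    refine Set.inter_eq_left.2 fun w hw => hrt ?_
    exact Metric.ball_subset_ball (min_le_left _ _) hw
  · exact fun y hy => interior_subset hy.1.2

/-! ### Power charts and local orders of a holomorphic map. -/

section PowerChart

variable {S S₀ : Type*} [TopologicalSpace S] [ChartedSpace ℂ S] [TopologicalSpace S₀]
  [ChartedSpace ℂ S₀]

/-- A holomorphic chart centred at `z`, with a disc as target, in which `β` is the power map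
`t ↦ t ^ localOrder β z`, up to a translation in the preferred chart at `β z`. -/
structure PowerChart (β : S → S₀) (z : S) where
  chart : OpenPartialHomeomorph S ℂ
  radius : ℝ
  radius_pos : 0 < radius
  radius_le_one : radius ≤ 1
  mem_source : z ∈ chart.source
  chart_self : chart z = 0
  target_eq : chart.target = Metric.ball 0 radius
  mdifferentiable : chart.MDifferentiable 𝓘(ℂ) 𝓘(ℂ)
  mapsTo : ∀ y ∈ chart.source, β y ∈ (chartAt ℂ (β z)).source
  apply_eq : ∀ y ∈ chart.source,
    chartAt ℂ (β z) (β y) = chartAt ℂ (β z) (β z) + chart y ^ localOrder β z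

theorem analyticAt_chart_expression [IsManifold 𝓘(ℂ) ω S] [IsManifold 𝓘(ℂ) ω S₀] {β : S → S₀}
    (hβ : MDifferentiable 𝓘(ℂ) 𝓘(ℂ) β) (z : S) :
    AnalyticAt ℂ (fun t : ℂ =>
      chartAt ℂ (β z) (β ((chartAt ℂ z).symm t)) - chartAt ℂ (β z) (β z)) (chartAt ℂ z z) := by
  have hS : IsManifold 𝓘(ℂ) 1 S := IsManifold.of_le (n := ω) le_top
  have hS₀ : IsManifold 𝓘(ℂ) 1 S₀ := IsManifold.of_le (n := ω) le_top
  let O : Set ℂ := (chartAt ℂ z).target ∩ (chartAt ℂ z).symm ⁻¹' (β ⁻¹' (chartAt ℂ (β z)).source)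
  have hO : IsOpen O := (chartAt ℂ z).isOpen_inter_preimage_symm
    ((chartAt ℂ (β z)).open_source.preimage hβ.continuous)
  have hzO : chartAt ℂ z z ∈ O := by
    refine ⟨mem_chart_target ℂ z, ?_⟩
    simp only [Set.mem_preimage, (chartAt ℂ z).left_inv (mem_chart_source ℂ z)]
    exact mem_chart_source ℂ (β z)
  have hd : DifferentiableOn ℂ (fun t : ℂ => chartAt ℂ (β z) (β ((chartAt ℂ z).symm t))) O := by
    rw [← mdifferentiableOn_iff_differentiableOn]
    intro t ht
    refine MDifferentiableAt.mdifferentiableWithinAt ?_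
    have h1 : MDifferentiableAt 𝓘(ℂ) 𝓘(ℂ) (chartAt ℂ z).symm t :=
      (mdifferentiable_chart (I := 𝓘(ℂ)) z).mdifferentiableAt_symm ht.1
    have h2 : MDifferentiableAt 𝓘(ℂ) 𝓘(ℂ) (chartAt ℂ (β z)) (β ((chartAt ℂ z).symm t)) :=
      (mdifferentiable_chart (I := 𝓘(ℂ)) (β z)).mdifferentiableAt ht.2
    exact h2.comp t ((hβ _).comp t h1)
  exact (hd.analyticAt (hO.mem_nhds hzO)).sub analyticAt_const

theorem eventually_eq_of_analyticOrderAt_eq_top [IsManifold 𝓘(ℂ) ω S] [IsManifold 𝓘(ℂ) ω S₀]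
    {β : S → S₀} (hβ : MDifferentiable 𝓘(ℂ) 𝓘(ℂ) β) (z : S) (h : analyticOrderAt (fun t : ℂ =>
      chartAt ℂ (β z) (β ((chartAt ℂ z).symm t)) - chartAt ℂ (β z) (β z)) (chartAt ℂ z z) = ⊤) :
    ∀ᶠ y in 𝓝 z, β y = β z := by
  rw [analyticOrderAt_eq_top] at h
  have h1 := ((chartAt ℂ z).continuousAt (mem_chart_source ℂ z)).eventually h
  filter_upwards [h1, (chartAt ℂ z).open_source.mem_nhds (mem_chart_source ℂ z),
    hβ.continuous.continuousAt.preimage_mem_nhds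
      ((chartAt ℂ (β z)).open_source.mem_nhds (mem_chart_source ℂ (β z)))] with y hy hys hyβ
  rw [(chartAt ℂ z).left_inv hys, sub_eq_zero] at hy
  exact (chartAt ℂ (β z)).injOn hyβ (mem_chart_source ℂ (β z)) hy

/-- The expanded function vanishes at the base point, so its true order is never 0; the value 0 can
only be the default value standing for infinite order. -/
theorem localOrder_eq_zero_iff [IsManifold 𝓘(ℂ) ω S] [IsManifold 𝓘(ℂ) ω S₀]
    {β : S → S₀} (hβ : MDifferentiable 𝓘(ℂ) 𝓘(ℂ) β) (z : S) :
    localOrder β z = 0 ↔ analyticOrderAt (fun t : ℂ =>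
      chartAt ℂ (β z) (β ((chartAt ℂ z).symm t)) - chartAt ℂ (β z) (β z)) (chartAt ℂ z z) = ⊤ := by
  have hne : analyticOrderAt (fun t : ℂ =>
      chartAt ℂ (β z) (β ((chartAt ℂ z).symm t)) - chartAt ℂ (β z) (β z)) (chartAt ℂ z z) ≠ 0 := by
    rw [(analyticAt_chart_expression hβ z).analyticOrderAt_ne_zero]
    simp [(chartAt ℂ z).left_inv (mem_chart_source ℂ z)]
  unfold localOrder analyticOrderNatAt
  rw [ENat.toNat_eq_zero]
  exact ⟨fun h => h.resolve_left hne, Or.inr⟩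

/-- Write the local expression as the n-th power of a function with a simple zero; by the inverse
function theorem that function is a coordinate, which is then shrunk to a disc. -/
theorem nonempty_powerChart [IsManifold 𝓘(ℂ) ω S] [IsManifold 𝓘(ℂ) ω S₀]
    {β : S → S₀} (hβ : MDifferentiable 𝓘(ℂ) 𝓘(ℂ) β) {z : S} (hz : localOrder β z ≠ 0) :
    Nonempty (PowerChart β z) := by
  have hS : IsManifold 𝓘(ℂ) 1 S := IsManifold.of_le (n := ω) le_top
  have hS₀ : IsManifold 𝓘(ℂ) 1 S₀ := IsManifold.of_le (n := ω) le_top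
  have htop := (localOrder_eq_zero_iff hβ z).not.1 hz
  obtain ⟨g, hg, hg0, hgd, hge⟩ := (analyticAt_chart_expression hβ z).exists_eventually_eq_pow hz
    (Nat.cast_analyticOrderNatAt htop).symm
  obtain ⟨G, hG, hGg, hGd⟩ := hg.exists_openPartialHomeomorph hgd
  have h1 := ((chartAt ℂ z).continuousAt (mem_chart_source ℂ z)).eventually hge
  obtain ⟨e, r, hr, hr1, hze, hee, ht, hd, hs⟩ :=
    OpenPartialHomeomorph.exists_target_eq_ball ((chartAt ℂ z).trans G) (z := z)
      ⟨mem_chart_source ℂ z, hG⟩ ((hGg _).trans hg0)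
      ((mdifferentiable_chart (I := 𝓘(ℂ)) z).trans hGd)
      (Filter.inter_mem h1 (Filter.inter_mem
        ((chartAt ℂ z).open_source.mem_nhds (mem_chart_source ℂ z))
        (hβ.continuous.continuousAt.preimage_mem_nhds
          ((chartAt ℂ (β z)).open_source.mem_nhds (mem_chart_source ℂ (β z))))))
  refine ⟨⟨e, r, hr, hr1, hze, (hee z).trans ((hGg _).trans hg0), ht, hd,
    fun y hy => (hs hy).2.2, fun y hy => ?_⟩⟩
  have h2 : chartAt ℂ (β z) (β ((chartAt ℂ z).symm (chartAt ℂ z y))) - chartAt ℂ (β z) (β z)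
    = g (chartAt ℂ z y) ^ localOrder β z := (hs hy).1
  rw [(chartAt ℂ z).left_inv (hs hy).2.1, sub_eq_iff_eq_add'] at h2
  rw [h2, hee y]
  exact congrArg (fun t => _ + t ^ _) (hGg _).symm

namespace PowerChart

variable {β : S → S₀} {z : S} (P : PowerChart β z)

theorem zero_mem_target : (0 : ℂ) ∈ P.chart.target := by
  rw [P.target_eq]; exact Metric.mem_ball_self P.radius_pos

theorem symm_zero : P.chart.symm 0 = z := by
  rw [← P.chart_self, P.chart.left_inv P.mem_source]

theorem eq_iff {x y : S} (hx : x ∈ P.chart.source) (hy : y ∈ P.chart.source) :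
    β x = β y ↔ P.chart x ^ localOrder β z = P.chart y ^ localOrder β z := by
  rw [← (chartAt ℂ (β z)).injOn.eq_iff (P.mapsTo x hx) (P.mapsTo y hy), P.apply_eq x hx,
    P.apply_eq y hy, add_right_inj]

/-- The derivative of t ↦ t^n does not vanish away from 0. -/
theorem exists_injOn_of_ne (hz : localOrder β z ≠ 0) {y : S} (hy : y ∈ P.chart.source)
    (hyz : y ≠ z) : ∃ U ∈ 𝓝 y, Set.InjOn β U := by
  have hne : P.chart y ≠ 0 := by
    rw [← P.chart_self]
    exact fun h => hyz (P.chart.injOn hy P.mem_source h)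
  have hd := hasStrictDerivAt_pow (localOrder β z) (P.chart y)
  have hd0 : (localOrder β z : ℂ) * P.chart y ^ (localOrder β z - 1) ≠ 0 :=
    mul_ne_zero (by exact_mod_cast hz) (pow_ne_zero _ hne)
  let h := (hd.hasStrictFDerivAt_equiv hd0).toOpenPartialHomeomorph (fun t => t ^ localOrder β z)
  have hh : h.source ∈ 𝓝 (P.chart y) := h.open_source.mem_nhds
    (hd.hasStrictFDerivAt_equiv hd0).mem_toOpenPartialHomeomorph_source
  refine ⟨P.chart.source ∩ P.chart ⁻¹' h.source, Filter.inter_mem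
    (P.chart.open_source.mem_nhds hy) (P.chart.continuousAt hy hh), ?_⟩
  intro x hx x' hx' hxx
  rw [P.eq_iff hx.1 hx'.1] at hxx
  exact P.chart.injOn hx.1 hx'.1 (h.injOn hx.2 hx'.2 hxx)

/-- For a primitive n-th root of unity η, the points with coordinates t and ηt have the same image,
so injectivity near the centre forces η = 1. -/
theorem localOrder_eq_one_of_injOn (P : PowerChart β z) (hz : localOrder β z ≠ 0) {U : Set S} (hU : U ∈ 𝓝 z)
    (hinj : Set.InjOn β U) : localOrder β z = 1 := by
  by_contra h1
  have hprim := Complex.isPrimitiveRoot_exp _ hz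
  set η := Complex.exp (2 * Real.pi * Complex.I / (localOrder β z : ℂ))
  have hcont : ContinuousAt P.chart.symm 0 := P.chart.continuousAt_symm P.zero_mem_target
  have hU' : ∀ᶠ t in 𝓝 (0 : ℂ), P.chart.symm t ∈ U ∧ t ∈ P.chart.target := by
    refine (hcont.eventually ?_).and (P.chart.open_target.mem_nhds P.zero_mem_target)
    rw [P.symm_zero]; exact hU
  have hmul : Filter.Tendsto (fun t : ℂ => η * t) (𝓝 0) (𝓝 0) := by
    have : Continuous (fun t : ℂ => η * t) := by fun_prop
    simpa using this.tendsto 0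
  have hev : ∀ᶠ t in 𝓝[≠] (0 : ℂ), t ≠ 0 ∧ (P.chart.symm t ∈ U ∧ t ∈ P.chart.target) ∧
      (P.chart.symm (η * t) ∈ U ∧ η * t ∈ P.chart.target) :=
    Filter.Eventually.and self_mem_nhdsWithin
      ((hU'.and (hmul.eventually hU')).filter_mono nhdsWithin_le_nhds)
  obtain ⟨t, ht0, ⟨ht1, ht2⟩, ht3, ht4⟩ := hev.exists
  have h2 : β (P.chart.symm t) = β (P.chart.symm (η * t)) := by
    rw [P.eq_iff (P.chart.map_target ht2) (P.chart.map_target ht4), P.chart.right_inv ht2,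
      P.chart.right_inv ht4, mul_pow, hprim.pow_eq_one, one_mul]
  have h3 : t = η * t := P.chart.symm.injOn ht2 ht4 (hinj ht1 ht3 h2)
  have h4 : η = 1 := by
    have : (η - 1) * t = 0 := by linear_combination -h3
    rcases mul_eq_zero.1 this with h | h
    · linear_combination h
    · exact absurd h ht0
  exact h1 (by simpa using (hprim.pow_eq_one_iff_dvd 1).1 (by simp [h4]))

end PowerChart

/-- A non-constant holomorphic map on a connected Riemann surface has positive order at every
point. -/
theorem localOrder_ne_zero [IsManifold 𝓘(ℂ) ω S] [IsManifold 𝓘(ℂ) ω S₀] [PreconnectedSpace S]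
    {β : S → S₀} (hβ : MDifferentiable 𝓘(ℂ) 𝓘(ℂ) β) (hne : ∃ x y, β x ≠ β y) (z : S) :
    localOrder β z ≠ 0 := by
  intro h0
  -- Order 0 means that β is locally constant at the point, which is an open condition.
  have hopen : IsOpen {y : S | localOrder β y = 0} := by
    have : {y : S | localOrder β y = 0} = {y | ∀ᶠ x in 𝓝 y, β x = β y} := by
      ext y
      refine ⟨fun h => eventually_eq_of_analyticOrderAt_eq_top hβ y
        ((localOrder_eq_zero_iff hβ y).1 h), fun h => ?_⟩
      by_contra hy
      obtain ⟨P⟩ := nonempty_powerChart hβ hy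
      have h1 := (P.chart.continuousAt_symm P.zero_mem_target).eventually
        (p := fun x => β x = β y) (by rw [P.symm_zero]; exact h)
      have h2 := (h1.and (P.chart.open_target.mem_nhds P.zero_mem_target)).filter_mono
        (nhdsWithin_le_nhds (s := {0}ᶜ))
      obtain ⟨t, ht0, ht, htt⟩ := (Filter.Eventually.and (f := 𝓝[≠] (0 : ℂ)) self_mem_nhdsWithin h2).exists
      rw [P.eq_iff (P.chart.map_target htt) P.mem_source, P.chart.right_inv htt, P.chart_self,
        zero_pow hy] at ht
      exact ht0 (pow_eq_zero_iff hy |>.1 ht)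
    rw [this, isOpen_iff_eventually]
    intro y hy
    filter_upwards [eventually_eventually_nhds.2 hy, hy] with x hx hxy
    filter_upwards [hx] with w hw
    rw [hw, hxy]
  -- Around a point of positive order, β is locally injective at every other nearby point, hence not
  -- locally constant there.
  have hclosed : IsClosed {y : S | localOrder β y = 0} := by
    rw [← isOpen_compl_iff, isOpen_iff_mem_nhds]
    intro y hy
    obtain ⟨P⟩ := nonempty_powerChart hβ hy
    filter_upwards [P.chart.open_source.mem_nhds P.mem_source] with x hx hx0
    rcases eq_or_ne x y with rfl | hxy
    · exact hy hx0
    · obtain ⟨U, hU, hinj⟩ := P.exists_injOn_of_ne hy hx hxy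
      have h1 : ∀ᶠ w in 𝓝 x, β w = β x := eventually_eq_of_analyticOrderAt_eq_top hβ x
        ((localOrder_eq_zero_iff hβ x).1 hx0)
      have hcont := P.chart.continuousAt_symm (P.chart.map_source hx)
      have h2 := hcont.eventually (p := fun w => w ∈ U ∧ β w = β x) (by
        rw [P.chart.left_inv hx]; exact Filter.inter_mem hU h1)
      have h3 := (h2.and (P.chart.open_target.mem_nhds (P.chart.map_source hx))).filter_mono
        (nhdsWithin_le_nhds (s := {P.chart x}ᶜ))
      obtain ⟨t, ht0, ⟨htU, ht⟩, htt⟩ := (Filter.Eventually.and (f := 𝓝[≠] (P.chart x)) self_mem_nhdsWithin h3).exists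
      have h4 : P.chart.symm t = x := hinj htU (mem_of_mem_nhds hU) ht
      exact ht0 (by rw [← P.chart.right_inv htt, h4]; rfl)
  have huniv := IsClopen.eq_univ ⟨hclosed, hopen⟩ ⟨z, h0⟩
  have hloc : IsLocallyConstant β := by
    rw [IsLocallyConstant.iff_eventually_eq]
    intro y
    exact eventually_eq_of_analyticOrderAt_eq_top hβ y ((localOrder_eq_zero_iff hβ y).1
      (huniv.symm ▸ Set.mem_univ y : y ∈ {y : S | localOrder β y = 0}))
  obtain ⟨x, y, hxy⟩ := hne
  exact hxy (hloc.apply_eq_of_preconnectedSpace x y)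

theorem PowerChart.localOrder_eq_one [IsManifold 𝓘(ℂ) ω S] [IsManifold 𝓘(ℂ) ω S₀] {β : S → S₀}
    (hβ : MDifferentiable 𝓘(ℂ) 𝓘(ℂ) β) (h0 : ∀ z, localOrder β z ≠ 0) {z y : S}
    (P : PowerChart β z) (hy : y ∈ P.chart.source) (hyz : y ≠ z) : localOrder β y = 1 := by
  obtain ⟨U, hU, hinj⟩ := P.exists_injOn_of_ne (h0 z) hy hyz
  obtain ⟨Q⟩ := nonempty_powerChart hβ (h0 y)
  exact Q.localOrder_eq_one_of_injOn (h0 y) hU hinj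

end PowerChart

theorem Function.Pullback.ext {X Y Z : Type*} {f : X → Y} {g : Z → Y} {x y : Function.Pullback f g}
    (h₁ : x.fst = y.fst) (h₂ : x.snd = y.snd) : x = y := Subtype.ext (Prod.ext h₁ h₂)

/-! ### Branches of the fiber product and their parametrizations. -/

section BranchPoint

variable {S₁ S₂ S₀ : Type*} [TopologicalSpace S₁] [ChartedSpace ℂ S₁] [TopologicalSpace S₂]
  [ChartedSpace ℂ S₂] [TopologicalSpace S₀] [ChartedSpace ℂ S₀]

/-- A point of the normalization of the fiber product: a point of the fiber product at which the
local orders are `m` and `n`, together with one of the `gcd m n` branches through it. In power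
charts the fiber product is `t ^ m = s ^ n`, and its branches are the curves
`t ^ (m / g) = ξ * s ^ (n / g)` for `g = gcd m n` and `ξ ^ g = 1`. -/
@[ext]
structure BranchPoint (β₁ : S₁ → S₀) (β₂ : S₂ → S₀) where
  point : Function.Pullback β₁ β₂
  root : ℂ
  root_pow : root ^ Nat.gcd (localOrder β₁ point.fst) (localOrder β₂ point.snd) = 1

/-- The order at a branch through `x` of the projection to the first factor. -/
noncomputable def fstOrder {β₁ : S₁ → S₀} {β₂ : S₂ → S₀} (x : Function.Pullback β₁ β₂) : ℕ :=
  localOrder β₂ x.snd / Nat.gcd (localOrder β₁ x.fst) (localOrder β₂ x.snd)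

/-- The order at a branch through `x` of the projection to the second factor. -/
noncomputable def sndOrder {β₁ : S₁ → S₀} {β₂ : S₂ → S₀} (x : Function.Pullback β₁ β₂) : ℕ :=
  localOrder β₁ x.fst / Nat.gcd (localOrder β₁ x.fst) (localOrder β₂ x.snd)

/-- Power charts for two holomorphic maps at all points. -/
structure FiberProductCharts (β₁ : S₁ → S₀) (β₂ : S₂ → S₀) where
  fst : ∀ z, PowerChart β₁ z
  snd : ∀ z, PowerChart β₂ z
  fst_ne_zero : ∀ z, localOrder β₁ z ≠ 0
  snd_ne_zero : ∀ z, localOrder β₂ z ≠ 0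
  fst_eq_one : ∀ z, ∀ y ∈ (fst z).chart.source, y ≠ z → localOrder β₁ y = 1
  snd_eq_one : ∀ z, ∀ y ∈ (snd z).chart.source, y ≠ z → localOrder β₂ y = 1

namespace FiberProductCharts

variable {β₁ : S₁ → S₀} {β₂ : S₂ → S₀} (D : FiberProductCharts β₁ β₂)

theorem gcd_pos (D : FiberProductCharts β₁ β₂) (x : Function.Pullback β₁ β₂) :
    0 < Nat.gcd (localOrder β₁ x.fst) (localOrder β₂ x.snd) :=
  Nat.gcd_pos_of_pos_left _ (Nat.pos_of_ne_zero (D.fst_ne_zero _))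

theorem fstOrder_mul_gcd (x : Function.Pullback β₁ β₂) :
    fstOrder x * Nat.gcd (localOrder β₁ x.fst) (localOrder β₂ x.snd) = localOrder β₂ x.snd :=
  Nat.div_mul_cancel (Nat.gcd_dvd_right _ _)

theorem sndOrder_mul_gcd (x : Function.Pullback β₁ β₂) :
    sndOrder x * Nat.gcd (localOrder β₁ x.fst) (localOrder β₂ x.snd) = localOrder β₁ x.fst :=
  Nat.div_mul_cancel (Nat.gcd_dvd_left _ _)

theorem localOrder_mul_fstOrder (x : Function.Pullback β₁ β₂) :
    localOrder β₁ x.fst * fstOrder x = localOrder β₂ x.snd * sndOrder x := by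
  calc _ = sndOrder x * Nat.gcd (localOrder β₁ x.fst) (localOrder β₂ x.snd) * fstOrder x := by
        rw [sndOrder_mul_gcd]
    _ = fstOrder x * Nat.gcd (localOrder β₁ x.fst) (localOrder β₂ x.snd) * sndOrder x := by ring
    _ = _ := by rw [fstOrder_mul_gcd]

theorem fstOrder_ne_zero (D : FiberProductCharts β₁ β₂) (x : Function.Pullback β₁ β₂) :
    fstOrder x ≠ 0 := fun h =>
  D.snd_ne_zero x.snd (by rw [← fstOrder_mul_gcd x, h, zero_mul])

theorem sndOrder_ne_zero (D : FiberProductCharts β₁ β₂) (x : Function.Pullback β₁ β₂) :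
    sndOrder x ≠ 0 := fun h =>
  D.fst_ne_zero x.fst (by rw [← sndOrder_mul_gcd x, h, zero_mul])

theorem coprime_orders (D : FiberProductCharts β₁ β₂) (x : Function.Pullback β₁ β₂) :
    (sndOrder x).Coprime (fstOrder x) :=
  Nat.coprime_div_gcd_div_gcd (D.gcd_pos x)

/-- Both power charts are normalized by the same chart of S₀, the one at the common image of the two
coordinates of x; this is what yields the equation t^m = s^n without a unit factor. -/
theorem fst_apply_eq_snd_apply_iff (x : Function.Pullback β₁ β₂) {y₁ : S₁} {y₂ : S₂}
    (h₁ : y₁ ∈ (D.fst x.fst).chart.source) (h₂ : y₂ ∈ (D.snd x.snd).chart.source) :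
    β₁ y₁ = β₂ y₂ ↔ (D.fst x.fst).chart y₁ ^ localOrder β₁ x.fst =
      (D.snd x.snd).chart y₂ ^ localOrder β₂ x.snd := by
  have hx : β₁ x.fst = β₂ x.snd := x.2
  have e₁ := (D.fst x.fst).apply_eq y₁ h₁
  have e₂ := (D.snd x.snd).apply_eq y₂ h₂
  have m₁ := (D.fst x.fst).mapsTo y₁ h₁
  have m₂ := (D.snd x.snd).mapsTo y₂ h₂
  rw [← hx] at e₂ m₂
  rw [← (chartAt ℂ (β₁ x.fst)).injOn.eq_iff m₁ m₂, e₁, e₂, add_right_inj]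

/-- The radius of the disc which parametrizes the branches through `x`. -/
noncomputable def radius (x : Function.Pullback β₁ β₂) : ℝ :=
  min (D.fst x.fst).radius (D.snd x.snd).radius

theorem radius_pos (x : Function.Pullback β₁ β₂) : 0 < D.radius x :=
  lt_min (D.fst x.fst).radius_pos (D.snd x.snd).radius_pos

theorem norm_pow_lt {x : Function.Pullback β₁ β₂} {u : ℂ} (hu : u ∈ Metric.ball 0 (D.radius x))
    {k : ℕ} (hk : k ≠ 0) : ‖u‖ ^ k < D.radius x := by
  rw [mem_ball_zero_iff] at hu
  have h1 : D.radius x ≤ 1 := (min_le_left _ _).trans (D.fst x.fst).radius_le_one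
  exact (pow_le_of_le_one (norm_nonneg u) (hu.le.trans h1) hk).trans_lt hu

/-- The scaling factor of the second coordinate on a branch. -/
noncomputable def coeff (p : BranchPoint β₁ β₂) : ℂ := (p.root⁻¹) ^ ((fstOrder p.point : ℂ)⁻¹)

theorem coeff_pow (D : FiberProductCharts β₁ β₂) (p : BranchPoint β₁ β₂) :
    coeff p ^ fstOrder p.point = p.root⁻¹ :=
  Complex.cpow_nat_inv_pow _ (D.fstOrder_ne_zero _)

theorem norm_coeff (D : FiberProductCharts β₁ β₂) (p : BranchPoint β₁ β₂) : ‖coeff p‖ = 1 := by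
  have h1 : ‖p.root‖ = 1 :=
    Complex.norm_eq_one_of_pow_eq_one p.root_pow (D.gcd_pos p.point).ne'
  have h2 : ‖coeff p‖ ^ fstOrder p.point = 1 := by
    rw [← norm_pow, D.coeff_pow, norm_inv, h1, inv_one]
  exact (pow_eq_one_iff_of_nonneg (norm_nonneg _) (D.fstOrder_ne_zero _)).1 h2

theorem coeff_ne_zero (D : FiberProductCharts β₁ β₂) (p : BranchPoint β₁ β₂) : coeff p ≠ 0 := by
  rw [← norm_ne_zero_iff, D.norm_coeff]; exact one_ne_zero

/-- The first coordinate of the parametrization of a branch. -/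
noncomputable def fstCurve (p : BranchPoint β₁ β₂) (u : ℂ) : S₁ :=
  (D.fst p.point.fst).chart.symm (u ^ fstOrder p.point)

/-- The second coordinate of the parametrization of a branch. -/
noncomputable def sndCurve (p : BranchPoint β₁ β₂) (u : ℂ) : S₂ :=
  (D.snd p.point.snd).chart.symm (coeff p * u ^ sndOrder p.point)

variable {p q : BranchPoint β₁ β₂} {u v : ℂ}

theorem pow_mem_target (hu : u ∈ Metric.ball 0 (D.radius p.point)) :
    u ^ fstOrder p.point ∈ (D.fst p.point.fst).chart.target := by
  rw [PowerChart.target_eq, mem_ball_zero_iff, norm_pow]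
  exact (D.norm_pow_lt hu (D.fstOrder_ne_zero _)).trans_le (min_le_left _ _)

theorem coeff_mul_pow_mem_target (hu : u ∈ Metric.ball 0 (D.radius p.point)) :
    coeff p * u ^ sndOrder p.point ∈ (D.snd p.point.snd).chart.target := by
  rw [PowerChart.target_eq, mem_ball_zero_iff, norm_mul, D.norm_coeff, one_mul, norm_pow]
  exact (D.norm_pow_lt hu (D.sndOrder_ne_zero _)).trans_le (min_le_right _ _)

theorem fstCurve_mem_source (hu : u ∈ Metric.ball 0 (D.radius p.point)) :
    D.fstCurve p u ∈ (D.fst p.point.fst).chart.source :=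
  (D.fst p.point.fst).chart.map_target (D.pow_mem_target hu)

theorem sndCurve_mem_source (hu : u ∈ Metric.ball 0 (D.radius p.point)) :
    D.sndCurve p u ∈ (D.snd p.point.snd).chart.source :=
  (D.snd p.point.snd).chart.map_target (D.coeff_mul_pow_mem_target hu)

theorem chart_fstCurve (hu : u ∈ Metric.ball 0 (D.radius p.point)) :
    (D.fst p.point.fst).chart (D.fstCurve p u) = u ^ fstOrder p.point :=
  (D.fst p.point.fst).chart.right_inv (D.pow_mem_target hu)

theorem chart_sndCurve (hu : u ∈ Metric.ball 0 (D.radius p.point)) :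
    (D.snd p.point.snd).chart (D.sndCurve p u) = coeff p * u ^ sndOrder p.point :=
  (D.snd p.point.snd).chart.right_inv (D.coeff_mul_pow_mem_target hu)

theorem fst_fstCurve_eq (hu : u ∈ Metric.ball 0 (D.radius p.point)) :
    β₁ (D.fstCurve p u) = β₂ (D.sndCurve p u) := by
  rw [D.fst_apply_eq_snd_apply_iff p.point (D.fstCurve_mem_source hu) (D.sndCurve_mem_source hu),
    D.chart_fstCurve hu, D.chart_sndCurve hu]
  -- Since n = a g, the power c^n is ξ⁻¹ raised to the g, which is 1.
  have h1 : coeff p ^ localOrder β₂ p.point.snd = 1 := by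
    rw [← fstOrder_mul_gcd p.point, pow_mul, D.coeff_pow, inv_pow, p.root_pow, inv_one]
  rw [mul_pow, h1, one_mul, ← pow_mul, ← pow_mul, mul_comm (fstOrder _), mul_comm (sndOrder _),
    localOrder_mul_fstOrder]

open Classical in
/-- The parametrization of a branch of the fiber product. -/
noncomputable def curve (p : BranchPoint β₁ β₂) (u : ℂ) : Function.Pullback β₁ β₂ :=
  if hu : u ∈ Metric.ball 0 (D.radius p.point) then
    ⟨(D.fstCurve p u, D.sndCurve p u), D.fst_fstCurve_eq hu⟩ else p.point

theorem curve_fst (hu : u ∈ Metric.ball 0 (D.radius p.point)) :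
    (D.curve p u).fst = D.fstCurve p u := by
  simp only [curve, dif_pos hu]; rfl

theorem curve_snd (hu : u ∈ Metric.ball 0 (D.radius p.point)) :
    (D.curve p u).snd = D.sndCurve p u := by
  simp only [curve, dif_pos hu]; rfl

theorem zero_mem_ball (x : Function.Pullback β₁ β₂) : (0 : ℂ) ∈ Metric.ball 0 (D.radius x) :=
  Metric.mem_ball_self (D.radius_pos x)

theorem curve_zero (p : BranchPoint β₁ β₂) : D.curve p 0 = p.point := by
  refine Function.Pullback.ext ?_ ?_
  · rw [D.curve_fst (D.zero_mem_ball _), fstCurve, zero_pow (D.fstOrder_ne_zero _),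
      PowerChart.symm_zero]
  · rw [D.curve_snd (D.zero_mem_ball _), sndCurve, zero_pow (D.sndOrder_ne_zero _), mul_zero,
      PowerChart.symm_zero]

theorem curve_fst_order (hu : u ∈ Metric.ball 0 (D.radius p.point)) (h0 : u ≠ 0) :
    localOrder β₁ (D.curve p u).fst = 1 := by
  rw [D.curve_fst hu]
  refine D.fst_eq_one _ _ (D.fstCurve_mem_source hu) fun h => ?_
  have := D.chart_fstCurve hu
  rw [h, PowerChart.chart_self] at this
  exact pow_ne_zero _ h0 this.symm

theorem curve_snd_order (hu : u ∈ Metric.ball 0 (D.radius p.point)) (h0 : u ≠ 0) :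
    localOrder β₂ (D.curve p u).snd = 1 := by
  rw [D.curve_snd hu]
  refine D.snd_eq_one _ _ (D.sndCurve_mem_source hu) fun h => ?_
  have := D.chart_sndCurve hu
  rw [h, PowerChart.chart_self] at this
  exact mul_ne_zero (D.coeff_ne_zero p) (pow_ne_zero _ h0) this.symm

/-- Distinct branches through a point only meet there, and each one is parametrized
injectively. -/
theorem eq_of_curve_eq (hpq : p.point = q.point) (hu : u ∈ Metric.ball 0 (D.radius p.point))
    (hv : v ∈ Metric.ball 0 (D.radius q.point)) (h : D.curve p u = D.curve q v) :
    u = v ∧ (u = 0 ∨ p = q) := by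
  obtain ⟨x, ξ, hξ⟩ := p
  obtain ⟨y, ζ, hζ⟩ := q
  obtain rfl : x = y := hpq
  have h₁ := congrArg (fun y : Function.Pullback β₁ β₂ => (D.fst x.fst).chart y.fst) h
  have h₂ := congrArg (fun y : Function.Pullback β₁ β₂ => (D.snd x.snd).chart y.snd) h
  simp only [D.curve_fst hu, D.curve_fst hv, D.curve_snd hu, D.curve_snd hv] at h₁ h₂
  have e₁ := D.chart_fstCurve hu
  have e₂ := D.chart_fstCurve hv
  have e₃ := D.chart_sndCurve hu
  have e₄ := D.chart_sndCurve hv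
  rw [e₁, e₂] at h₁
  rw [e₃, e₄] at h₂
  simp only at h₁ h₂ e₁ e₂ e₃ e₄
  have ha := D.fstOrder_ne_zero x
  have hb := D.sndOrder_ne_zero x
  rcases eq_or_ne u 0 with rfl | hu0
  · rw [zero_pow ha] at h₁
    exact ⟨(pow_eq_zero_iff ha |>.1 h₁.symm).symm, Or.inl rfl⟩
  have hv0 : v ≠ 0 := by
    rintro rfl
    rw [zero_pow ha] at h₁
    exact hu0 (pow_eq_zero_iff ha |>.1 h₁)
  -- Taking a-th powers of c u^b = c' v^b and using u^a = v^a isolates the roots, which must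
  -- therefore agree.
  have h₃ := congrArg (· ^ fstOrder x) h₂
  simp only [mul_pow] at h₃
  have c₁ := D.coeff_pow ⟨x, ξ, hξ⟩
  have c₂ := D.coeff_pow ⟨x, ζ, hζ⟩
  simp only at c₁ c₂
  rw [c₁, c₂, ← pow_mul, ← pow_mul, mul_comm (sndOrder x), pow_mul, pow_mul, h₁] at h₃
  have h₄ : ξ = ζ := inv_injective (mul_right_cancel₀ (pow_ne_zero _ (pow_ne_zero _ hv0)) h₃)
  subst h₄
  have h₅ : u ^ sndOrder x = v ^ sndOrder x := mul_left_cancel₀ (D.coeff_ne_zero _) h₂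
  refine ⟨?_, Or.inr rfl⟩
  have h₆ : (u / v) ^ fstOrder x = 1 := by
    rw [div_pow, h₁, div_self (pow_ne_zero _ hv0)]
  have h₇ : (u / v) ^ sndOrder x = 1 := by
    rw [div_pow, h₅, div_self (pow_ne_zero _ hv0)]
  have h₈ : u / v = 1 := by
    -- The order of u/v divides the coprime exponents a and b.
    have := Nat.dvd_gcd (orderOf_dvd_of_pow_eq_one h₇) (orderOf_dvd_of_pow_eq_one h₆)
    rw [(D.coprime_orders x).gcd_eq_one, Nat.dvd_one, orderOf_eq_one_iff] at this
    exact this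
  exact (div_eq_one_iff_eq hv0).1 h₈

/-- Every point of the fiber product close to `x` lies on a branch through `x`. -/
theorem exists_curve_eq (x y : Function.Pullback β₁ β₂)
    (h₁ : y.fst ∈ (D.fst x.fst).chart.source) (h₂ : y.snd ∈ (D.snd x.snd).chart.source)
    {s : ℝ} (hs0 : 0 < s) (hs : s ≤ D.radius x)
    (hy : ‖(D.fst x.fst).chart y.fst‖ < s ^ fstOrder x) :
    ∃ p : BranchPoint β₁ β₂, p.point = x ∧ ∃ u : ℂ, ‖u‖ < s ∧ D.curve p u = y := by
  have hxy := (D.fst_apply_eq_snd_apply_iff x h₁ h₂).1 y.2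
  set t := (D.fst x.fst).chart y.fst with ht
  set w := (D.snd x.snd).chart y.snd with hw
  have ha := D.fstOrder_ne_zero x
  have hb := D.sndOrder_ne_zero x
  suffices h : ∃ p : BranchPoint β₁ β₂, p.point = x ∧ ∃ u : ℂ, u ^ fstOrder x = t ∧
      coeff p * u ^ sndOrder x = w by
    obtain ⟨p, rfl, u, hu₁, hu₂⟩ := h
    have hu : ‖u‖ < s := by
      rw [← hu₁, norm_pow] at hy
      exact lt_of_pow_lt_pow_left₀ _ hs0.le hy
    have hub : u ∈ Metric.ball 0 (D.radius p.point) := by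
      rw [mem_ball_zero_iff]; exact hu.trans_le hs
    refine ⟨p, rfl, u, hu, Function.Pullback.ext ?_ ?_⟩
    · rw [D.curve_fst hub, fstCurve, hu₁, ht, (D.fst _).chart.left_inv h₁]
    · rw [D.curve_snd hub, sndCurve, hu₂, hw, (D.snd _).chart.left_inv h₂]
  rcases eq_or_ne t 0 with h0 | h0
  · rw [h0, zero_pow (D.fst_ne_zero _)] at hxy
    -- Here y is x itself, which lies on every branch, so the root 1 serves.
    refine ⟨⟨x, 1, one_pow _⟩, rfl, 0, ?_, ?_⟩
    · rw [zero_pow ha, h0]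
    · rw [zero_pow hb, mul_zero, pow_eq_zero_iff (D.snd_ne_zero _) |>.1 hxy.symm]
  have hw0 : w ≠ 0 := by
    intro h
    rw [h, zero_pow (D.snd_ne_zero _)] at hxy
    exact h0 (pow_eq_zero_iff (D.fst_ne_zero _) |>.1 hxy)
  -- The root is read off from the branch equation t^b = ξ w^a; its g-th power is t^m / w^n = 1.
  let p : BranchPoint β₁ β₂ := ⟨x, t ^ sndOrder x / w ^ fstOrder x, by
    rw [div_pow, ← pow_mul, ← pow_mul, fstOrder_mul_gcd, sndOrder_mul_gcd, hxy,
      div_self (pow_ne_zero _ hw0)]⟩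
  have hc : coeff p ^ fstOrder x = w ^ fstOrder x / t ^ sndOrder x := by
    rw [← inv_div]; exact D.coeff_pow p
  have hc0 := D.coeff_ne_zero p
  have key : t ^ sndOrder x = (w / coeff p) ^ fstOrder x := by
    rw [div_pow, hc, div_div_cancel₀ (pow_ne_zero _ hw0)]
  -- Coprimality of a and b produces the uniformizer u, with t = u^a and w/c = u^b.
  obtain ⟨u, hu₁, hu₂⟩ := (pow_eq_pow_iff_of_coprime (D.coprime_orders x)).1 key
  refine ⟨p, rfl, u, hu₁.symm, ?_⟩
  rw [← hu₂, mul_div_cancel₀ _ hc0]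

theorem root_eq_one (h : localOrder β₁ p.point.fst = 1) : p.root = 1 := by
  have := p.root_pow
  rwa [h, Nat.gcd_one_left, pow_one] at this

theorem eq_of_point_eq (h : localOrder β₁ p.point.fst = 1) (hpq : p.point = q.point) : p = q := by
  refine BranchPoint.ext hpq ?_
  rw [root_eq_one h, root_eq_one (hpq ▸ h)]

open Classical in
/-- The parametrization of the normalization near `p`. -/
noncomputable def lift (p : BranchPoint β₁ β₂) (u : ℂ) : BranchPoint β₁ β₂ :=
  -- Off the centre of the disc both local orders are 1, so 1 is the only possible root; only the
  -- centre remembers the root of p.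
  if u = 0 then p else ⟨D.curve p u, 1, one_pow _⟩

theorem lift_zero (p : BranchPoint β₁ β₂) : D.lift p 0 = p := if_pos rfl

theorem lift_point (p : BranchPoint β₁ β₂) (u : ℂ) : (D.lift p u).point = D.curve p u := by
  unfold lift
  split_ifs with h
  · rw [h, D.curve_zero]
  · rfl

theorem injOn_lift (p : BranchPoint β₁ β₂) :
    Set.InjOn (D.lift p) (Metric.ball 0 (D.radius p.point)) := by
  intro u hu v hv h
  have := congrArg BranchPoint.point h
  rw [D.lift_point, D.lift_point] at this
  exact (D.eq_of_curve_eq rfl hu hv this).1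

/-- The chart of the normalization centred at `p`. -/
noncomputable def branchChart (p : BranchPoint β₁ β₂) : PartialEquiv (BranchPoint β₁ β₂) ℂ :=
  ((D.injOn_lift p).toPartialEquiv (D.lift p) _).symm

end FiberProductCharts
end BranchPoint

/-! ### The complex structure on the normalization. -/

section BranchPoint

variable {S₁ S₂ S₀ : Type*} [TopologicalSpace S₁] [ChartedSpace ℂ S₁] [TopologicalSpace S₂]
  [ChartedSpace ℂ S₂] [TopologicalSpace S₀] [ChartedSpace ℂ S₀]

namespace FiberProductCharts

variable {β₁ : S₁ → S₀} {β₂ : S₂ → S₀} (D : FiberProductCharts β₁ β₂)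

variable {p q : BranchPoint β₁ β₂} {u v : ℂ}

theorem branchChart_lift (hu : u ∈ Metric.ball 0 (D.radius p.point)) :
    D.branchChart p (D.lift p u) = u := (D.branchChart p).right_inv hu

theorem lift_mem_source (hu : u ∈ Metric.ball 0 (D.radius p.point)) :
    D.lift p u ∈ (D.branchChart p).source := Set.mem_image_of_mem _ hu

theorem mem_branchChart_source (p : BranchPoint β₁ β₂) : p ∈ (D.branchChart p).source :=
  ⟨0, D.zero_mem_ball _, D.lift_zero p⟩

/-- At points where both maps are unramified, the first coordinate of the parametrization of a
branch is a local biholomorphism. -/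
theorem exists_openPartialHomeomorph_fstCurve (hu : u ∈ Metric.ball 0 (D.radius p.point))
    (h : u ≠ 0 ∨ fstOrder p.point = 1) :
    ∃ A : OpenPartialHomeomorph ℂ S₁, u ∈ A.source ∧ A.source ⊆ Metric.ball 0 (D.radius p.point) ∧
      (∀ w, A w = D.fstCurve p w) ∧ A.MDifferentiable 𝓘(ℂ) 𝓘(ℂ) := by
  have han : AnalyticAt ℂ (fun w : ℂ => w ^ fstOrder p.point) u := analyticAt_id.pow _
  have hd : deriv (fun w : ℂ => w ^ fstOrder p.point) u ≠ 0 := by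
    rw [(hasDerivAt_pow _ u).deriv]
    refine mul_ne_zero (by exact_mod_cast D.fstOrder_ne_zero _) ?_
    rcases h with h | h
    · exact pow_ne_zero _ h
    · simp [h]
  obtain ⟨G, huG, hG, hGd⟩ := han.exists_openPartialHomeomorph hd
  let G' := G.restrOpen (Metric.ball 0 (D.radius p.point)) Metric.isOpen_ball
  have hG' : G'.MDifferentiable 𝓘(ℂ) 𝓘(ℂ) :=
    ⟨hGd.1.mono Set.inter_subset_left, hGd.2.mono Set.inter_subset_left⟩
  refine ⟨G'.trans (D.fst p.point.fst).chart.symm, ⟨⟨huG, hu⟩, ?_⟩, fun w hw => hw.1.2,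
    fun w => congrArg _ (hG w), hG'.trans (D.fst p.point.fst).mdifferentiable.symm⟩
  change G u ∈ (D.fst p.point.fst).chart.target
  rw [hG]
  exact D.pow_mem_target hu

theorem continuousAt_fstCurve (hu : u ∈ Metric.ball 0 (D.radius p.point)) :
    ContinuousAt (D.fstCurve p) u := by
  have h := (D.fst p.point.fst).chart.continuousAt_symm (D.pow_mem_target hu)
  exact ContinuousAt.comp (f := fun w : ℂ => w ^ fstOrder p.point) h (by fun_prop)

theorem continuousAt_sndCurve (hu : u ∈ Metric.ball 0 (D.radius p.point)) :
    ContinuousAt (D.sndCurve p) u := by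
  have h := (D.snd p.point.snd).chart.continuousAt_symm (D.coeff_mul_pow_mem_target hu)
  exact ContinuousAt.comp (f := fun w : ℂ => coeff p * w ^ sndOrder p.point) h (by fun_prop)

theorem fstOrder_eq_one {x : Function.Pullback β₁ β₂} (h₁ : localOrder β₁ x.fst = 1)
    (h₂ : localOrder β₂ x.snd = 1) : fstOrder x = 1 := by
  simp [fstOrder, h₁, h₂]

/-- The transition maps of the normalization are holomorphic. -/
theorem exists_transition (hpq : p ≠ q) (hu : u ∈ Metric.ball 0 (D.radius p.point))
    (hv : v ∈ Metric.ball 0 (D.radius q.point)) (huv : D.lift p u = D.lift q v) :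
    ∃ τ : ℂ → ℂ, DifferentiableAt ℂ τ u ∧ ∀ᶠ w in 𝓝 u, w ∈ Metric.ball 0 (D.radius p.point) ∧
      τ w ∈ Metric.ball 0 (D.radius q.point) ∧ D.lift p w = D.lift q (τ w) := by
  have hc : D.curve p u = D.curve q v := by rw [← D.lift_point, huv, D.lift_point]
  -- As p ≠ q, the parameters u and v are not both 0, and a nonzero parameter gives a point where
  -- both maps are unramified.
  have h1 : localOrder β₁ (D.curve p u).fst = 1 ∧ localOrder β₂ (D.curve p u).snd = 1 := by
    by_cases hu0 : u = 0
    · have hv0 : v ≠ 0 := by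
        rintro rfl
        rw [hu0, D.lift_zero, D.lift_zero] at huv
        exact hpq huv
      rw [hc]
      exact ⟨D.curve_fst_order hv hv0, D.curve_snd_order hv hv0⟩
    · exact ⟨D.curve_fst_order hu hu0, D.curve_snd_order hu hu0⟩
  have hup : u ≠ 0 ∨ fstOrder p.point = 1 := by
    refine or_iff_not_imp_left.2 fun h => ?_
    rw [not_not] at h
    rw [h, D.curve_zero] at h1
    exact fstOrder_eq_one h1.1 h1.2
  have hvq : v ≠ 0 ∨ fstOrder q.point = 1 := by
    refine or_iff_not_imp_left.2 fun h => ?_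
    rw [not_not] at h
    rw [hc, h, D.curve_zero] at h1
    exact fstOrder_eq_one h1.1 h1.2
  obtain ⟨A, huA, hAs, hA, hAd⟩ := D.exists_openPartialHomeomorph_fstCurve hu hup
  obtain ⟨B, hvB, hBs, hB, hBd⟩ := D.exists_openPartialHomeomorph_fstCurve hv hvq
  have hfst : D.fstCurve p u = D.fstCurve q v := by
    rw [← D.curve_fst hu, hc, D.curve_fst hv]
  have hsnd : D.sndCurve p u = D.sndCurve q v := by
    rw [← D.curve_snd hu, hc, D.curve_snd hv]
  have huT : u ∈ (A.trans B.symm).source := by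
    refine ⟨huA, ?_⟩
    change A u ∈ B.target
    rw [hA, hfst, ← hB]
    exact B.map_source hvB
  have hτu : (A.trans B.symm) u = v := by
    change B.symm (A u) = v
    rw [hA, hfst, ← hB, B.left_inv hvB]
  have hτd : DifferentiableAt ℂ (A.trans B.symm) u := by
    rw [← mdifferentiableAt_iff_differentiableAt]
    exact (hAd.trans hBd.symm).mdifferentiableAt huT
  -- The transition is determined by matching first coordinates; what is left is to see that the
  -- second coordinates and the roots then match too.
  refine ⟨A.trans B.symm, hτd, ?_⟩
  let Q := D.snd (D.curve p u).snd
  let P := D.fst (D.curve p u).fst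
  have hQ : Q.chart.source ∈ 𝓝 (D.sndCurve p u) := by
    rw [← D.curve_snd hu]; exact Q.chart.open_source.mem_nhds Q.mem_source
  have hP : P.chart.source ∈ 𝓝 (D.fstCurve p u) := by
    rw [← D.curve_fst hu]; exact P.chart.open_source.mem_nhds P.mem_source
  have hcont : ContinuousAt (fun w => D.sndCurve q ((A.trans B.symm) w)) u := by
    refine ContinuousAt.comp (g := D.sndCurve q) ?_ hτd.continuousAt
    rw [hτu]
    exact D.continuousAt_sndCurve hv
  have hcont' : ∀ᶠ w in 𝓝 u, D.sndCurve q ((A.trans B.symm) w) ∈ Q.chart.source := by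
    refine hcont ?_
    simp only [hτu]
    rwa [← hsnd]
  filter_upwards [(A.trans B.symm).open_source.mem_nhds huT, D.continuousAt_sndCurve hu hQ,
    D.continuousAt_fstCurve hu hP, hcont'] with w hw hwQ hwP hwQ'
  have hwp := hAs hw.1
  have hB' : (A.trans B.symm) w ∈ B.source := B.map_target hw.2
  have hwq := hBs hB'
  refine ⟨hwp, hwq, ?_⟩
  have e₁ : D.fstCurve q ((A.trans B.symm) w) = D.fstCurve p w := by
    rw [← hB, ← hA]; exact B.right_inv hw.2
  -- The two second coordinates have the same image under β₂ and lie in a power chart of order 1,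
  -- where β₂ is injective.
  have e₂ : D.sndCurve p w = D.sndCurve q ((A.trans B.symm) w) := by
    have h2 : localOrder β₂ (D.curve p u).snd = 1 := h1.2
    refine Q.chart.injOn hwQ hwQ' ?_
    have := (Q.eq_iff hwQ hwQ').1 (by
      rw [← D.fst_fstCurve_eq hwp, ← D.fst_fstCurve_eq hwq, e₁])
    rwa [h2, pow_one, pow_one] at this
  have e₃ : D.curve p w = D.curve q ((A.trans B.symm) w) := by
    refine Function.Pullback.ext ?_ ?_
    · rw [D.curve_fst hwp, D.curve_fst hwq, e₁]
    · rw [D.curve_snd hwp, D.curve_snd hwq, e₂]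
  refine eq_of_point_eq ?_ ?_
  · rw [D.lift_point, D.curve_fst hwp]
    rcases eq_or_ne (D.fstCurve p w) (D.curve p u).fst with h | h
    · rw [h]; exact h1.1
    · exact D.fst_eq_one _ _ hwP h
  · rw [D.lift_point, D.lift_point, e₃]

/-- A chart followed backwards and forwards is the identity, so possibly ramified centres cause no
trouble; distinct charts are handled by `exists_transition`. -/
theorem transition (p q : BranchPoint β₁ β₂)
    (hu : u ∈ ((D.branchChart p).symm.trans (D.branchChart q)).source) :
    ((D.branchChart p).symm.trans (D.branchChart q)).source ∈ 𝓝 u ∧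
      DifferentiableAt ℂ ((D.branchChart p).symm.trans (D.branchChart q)) u := by
  rcases eq_or_ne p q with rfl | hpq
  · have hball : Metric.ball 0 (D.radius p.point) ∈ 𝓝 u := Metric.isOpen_ball.mem_nhds hu.1
    refine ⟨Filter.mem_of_superset hball fun w hw => ⟨hw, D.lift_mem_source hw⟩, ?_⟩
    refine differentiableAt_id.congr_of_eventuallyEq ?_
    filter_upwards [hball] with w hw
    exact D.branchChart_lift hw
  · obtain ⟨hu₁, v, hv, hvu⟩ := hu
    obtain ⟨τ, hτ, he⟩ := D.exists_transition hpq hu₁ hv hvu.symm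
    refine ⟨?_, hτ.congr_of_eventuallyEq ?_⟩
    · filter_upwards [he] with w hw
      exact ⟨hw.1, τ w, hw.2.1, hw.2.2.symm⟩
    · filter_upwards [he] with w hw
      change D.branchChart q (D.lift p w) = τ w
      rw [hw.2.2, D.branchChart_lift hw.2.1]

/-- The atlas of the normalization. -/
noncomputable def core : ChartedSpaceCore ℂ (BranchPoint β₁ β₂) where
  atlas := Set.range D.branchChart
  chartAt := D.branchChart
  mem_chart_source := D.mem_branchChart_source
  chart_mem_atlas p := Set.mem_range_self p
  open_source := by
    rintro _ _ ⟨p, rfl⟩ ⟨q, rfl⟩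
    exact isOpen_iff_mem_nhds.2 fun u hu => (D.transition p q hu).1
  continuousOn_toFun := by
    rintro _ _ ⟨p, rfl⟩ ⟨q, rfl⟩
    exact fun u hu => (D.transition p q hu).2.continuousAt.continuousWithinAt

/-- The normalization of the fiber product, as a charted space. -/
def Normalization (_ : FiberProductCharts β₁ β₂) := BranchPoint β₁ β₂

noncomputable instance : TopologicalSpace D.Normalization := D.core.toTopologicalSpace

noncomputable instance : ChartedSpace ℂ D.Normalization := D.core.toChartedSpace

/-- The normalization map. -/
def toPullback (y : D.Normalization) : Function.Pullback β₁ β₂ := BranchPoint.point y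

/-- The inverse of the chart centred at `y`. -/
noncomputable def param (y : D.Normalization) (u : ℂ) : D.Normalization := D.lift y u

/-- The scaling factor of the second coordinate on the branch at `y`. -/
noncomputable def scale (y : D.Normalization) : ℂ := coeff (β₁ := β₁) (β₂ := β₂) y

theorem scale_ne_zero (y : D.Normalization) : D.scale y ≠ 0 := D.coeff_ne_zero y

theorem param_zero (y : D.Normalization) : D.param y 0 = y := D.lift_zero y

theorem chartAt_param {y : D.Normalization} (hu : u ∈ Metric.ball 0 (D.radius (D.toPullback y))) :
    chartAt ℂ y (D.param y u) = u := D.branchChart_lift hu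

theorem param_chartAt {y x : D.Normalization} (hx : x ∈ (chartAt ℂ y).source) :
    D.param y (chartAt ℂ y x) = x := (chartAt ℂ y).left_inv hx

theorem chartAt_self (y : D.Normalization) : chartAt ℂ y y = 0 := by
  have h : chartAt ℂ y (D.param y 0) = 0 := D.chartAt_param (D.zero_mem_ball _)
  rwa [D.param_zero] at h

theorem toPullback_param_fst {y : D.Normalization}
    (hu : u ∈ Metric.ball 0 (D.radius (D.toPullback y))) :
    (D.toPullback (D.param y u)).fst =
      (D.fst (D.toPullback y).fst).chart.symm (u ^ fstOrder (D.toPullback y)) :=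
  (congrArg _ (D.lift_point y u)).trans (D.curve_fst hu)

theorem toPullback_param_snd {y : D.Normalization}
    (hu : u ∈ Metric.ball 0 (D.radius (D.toPullback y))) :
    (D.toPullback (D.param y u)).snd =
      (D.snd (D.toPullback y).snd).chart.symm (D.scale y * u ^ sndOrder (D.toPullback y)) :=
  (congrArg _ (D.lift_point y u)).trans (D.curve_snd hu)

theorem pow_mem_fst_target {y : D.Normalization}
    (hu : u ∈ Metric.ball 0 (D.radius (D.toPullback y))) :
    u ^ fstOrder (D.toPullback y) ∈ (D.fst (D.toPullback y).fst).chart.target :=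
  D.pow_mem_target hu

theorem scale_mul_pow_mem_snd_target {y : D.Normalization}
    (hu : u ∈ Metric.ball 0 (D.radius (D.toPullback y))) :
    D.scale y * u ^ sndOrder (D.toPullback y) ∈ (D.snd (D.toPullback y).snd).chart.target :=
  D.coeff_mul_pow_mem_target hu

theorem orders_param {y : D.Normalization}
    (hu : u ∈ Metric.ball 0 (D.radius (D.toPullback y))) (h0 : u ≠ 0) :
    localOrder β₁ (D.toPullback (D.param y u)).fst = 1 ∧
      localOrder β₂ (D.toPullback (D.param y u)).snd = 1 := by
  have h : D.toPullback (D.param y u) = D.curve y u := D.lift_point y u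
  rw [h]
  exact ⟨D.curve_fst_order hu h0, D.curve_snd_order hu h0⟩

/-- A common point of the two discs has the same parameter in both, so it is either the centre of
both or lies on a single branch. This separates the points of R lying over one singular point of X.
-/
theorem disjoint_source {y y' : D.Normalization} (h : D.toPullback y = D.toPullback y')
    (hne : y ≠ y') : Disjoint (chartAt ℂ y).source (chartAt ℂ y').source := by
  rw [Set.disjoint_left]
  rintro _ ⟨u, hu, rfl⟩ ⟨v, hv, hvu⟩
  have hc : D.curve y u = D.curve y' v := (D.lift_point y u).symm.trans
    ((congrArg BranchPoint.point hvu.symm).trans (D.lift_point y' v))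
  obtain ⟨rfl, h0 | h0⟩ := D.eq_of_curve_eq h hu hv hc
  · subst h0
    have h₁ : D.param y' 0 = D.param y 0 := hvu
    rw [D.param_zero, D.param_zero] at h₁
    exact hne h₁.symm
  · exact hne h0

/-- Points of the normalization with the same unramified image agree. -/
theorem eq_of_toPullback_eq {y y' : D.Normalization} (h : D.toPullback y = D.toPullback y')
    (hg : Nat.gcd (localOrder β₁ (D.toPullback y).fst) (localOrder β₂ (D.toPullback y).snd) = 1) :
    y = y' := by
  have key : ∀ z : BranchPoint β₁ β₂, Nat.gcd (localOrder β₁ z.point.fst)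
      (localOrder β₂ z.point.snd) = 1 → z.root = 1 := fun z hz => by
    have := z.root_pow
    rwa [hz, pow_one] at this
  have hg' := hg
  rw [h] at hg'
  exact BranchPoint.ext h ((key y hg).trans (key y' hg').symm)

theorem exists_param_eq (x : Function.Pullback β₁ β₂) (y : D.Normalization)
    (h₁ : (D.toPullback y).fst ∈ (D.fst x.fst).chart.source)
    (h₂ : (D.toPullback y).snd ∈ (D.snd x.snd).chart.source)
    {s : ℝ} (hs0 : 0 < s) (hs : s ≤ D.radius x)
    (hy : ‖(D.fst x.fst).chart (D.toPullback y).fst‖ < s ^ fstOrder x) :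
    ∃ y' : D.Normalization, D.toPullback y' = x ∧ ∃ u : ℂ, ‖u‖ < s ∧ D.param y' u = y := by
  obtain ⟨p, rfl, u, hu, hpu⟩ := D.exists_curve_eq x (D.toPullback y) h₁ h₂ hs0 hs hy
  -- At the centre the branch found on X need not be the one carrying y, so y is taken as its own
  -- centre.
  rcases eq_or_ne u 0 with rfl | hu0
  · rw [D.curve_zero] at hpu
    exact ⟨y, hpu.symm, 0, hu, D.param_zero y⟩
  · have hub : u ∈ Metric.ball 0 (D.radius p.point) := by
      rw [mem_ball_zero_iff]; exact hu.trans_le hs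
    refine ⟨p, rfl, u, hu, eq_of_point_eq ?_ ?_⟩
    · exact (D.orders_param hub hu0).1
    · exact (D.lift_point p u).trans hpu

instance : IsManifold 𝓘(ℂ) ω D.Normalization := by
  refine isManifold_of_contDiffOn _ _ _ fun e e' he he' => ?_
  obtain ⟨_, ⟨_, rfl⟩, ⟨_, ⟨⟨p, rfl⟩, rfl⟩, rfl⟩⟩ := he
  obtain ⟨_, ⟨_, rfl⟩, ⟨_, ⟨⟨q, rfl⟩, rfl⟩, rfl⟩⟩ := he'
  simp only [mfld_simps]
  -- On an open subset of ℂ, complex differentiability already gives analyticity.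
  have hd : DifferentiableOn ℂ ((D.branchChart p).symm.trans (D.branchChart q))
      ((D.branchChart p).symm.trans (D.branchChart q)).source :=
    fun u hu => (D.transition p q hu).2.differentiableWithinAt
  exact hd.contDiffOn (isOpen_iff_mem_nhds.2 fun u hu => (D.transition p q hu).1)

end FiberProductCharts
end BranchPoint

/-! ### Topology of the normalization map: finiteness, separation, compactness. -/

theorem Set.finite_of_eventually_punctured_notMem {X : Type*} [TopologicalSpace X] [CompactSpace X]
    {A : Set X} (h : ∀ x, ∀ᶠ y in 𝓝 x, y ≠ x → y ∉ A) : A.Finite := by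
  have hc : IsCompact (Set.univ : Set X) := isCompact_univ
  obtain ⟨t, -, ht⟩ := hc.elim_nhds_subcover (fun x => {y | y ≠ x → y ∉ A}) (fun x _ => h x)
  refine t.finite_toSet.subset fun y hy => ?_
  obtain ⟨x, hx, hxy⟩ := Set.mem_iUnion₂.1 (ht (Set.mem_univ y))
  by_contra hyt
  exact hxy (fun h => hyt (h ▸ hx)) hy

section BranchPoint

variable {S₁ S₂ S₀ : Type*} [TopologicalSpace S₁] [ChartedSpace ℂ S₁] [TopologicalSpace S₂]
  [ChartedSpace ℂ S₂] [TopologicalSpace S₀] [ChartedSpace ℂ S₀]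

namespace FiberProductCharts

variable {β₁ : S₁ → S₀} {β₂ : S₂ → S₀} (D : FiberProductCharts β₁ β₂)

theorem chart_toPullback_fst {y x : D.Normalization} (hx : x ∈ (chartAt ℂ y).source) :
    (D.toPullback x).fst ∈ (D.fst (D.toPullback y).fst).chart.source ∧
      (D.fst (D.toPullback y).fst).chart (D.toPullback x).fst =
        chartAt ℂ y x ^ fstOrder (D.toPullback y) := by
  have hu := (chartAt ℂ y).map_source hx
  have ht := D.pow_mem_fst_target hu
  have h := D.toPullback_param_fst hu
  rw [D.param_chartAt hx] at h
  rw [h]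
  exact ⟨(D.fst _).chart.map_target ht, (D.fst _).chart.right_inv ht⟩

theorem chart_toPullback_snd {y x : D.Normalization} (hx : x ∈ (chartAt ℂ y).source) :
    (D.toPullback x).snd ∈ (D.snd (D.toPullback y).snd).chart.source ∧
      (D.snd (D.toPullback y).snd).chart (D.toPullback x).snd =
        D.scale y * chartAt ℂ y x ^ sndOrder (D.toPullback y) := by
  have hu := (chartAt ℂ y).map_source hx
  have ht := D.scale_mul_pow_mem_snd_target hu
  have h := D.toPullback_param_snd hu
  rw [D.param_chartAt hx] at h
  rw [h]
  exact ⟨(D.snd _).chart.map_target ht, (D.snd _).chart.right_inv ht⟩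

theorem orders_of_mem_source {y x : D.Normalization} (hx : x ∈ (chartAt ℂ y).source)
    (hxy : x ≠ y) : localOrder β₁ (D.toPullback x).fst = 1 ∧
      localOrder β₂ (D.toPullback x).snd = 1 := by
  have h := D.orders_param ((chartAt ℂ y).map_source hx) fun h0 => hxy (by
    rw [← D.param_chartAt hx, h0, D.param_zero])
  rwa [D.param_chartAt hx] at h

theorem mdifferentiableAt_chartAt (y : D.Normalization) :
    MDifferentiableAt 𝓘(ℂ) 𝓘(ℂ) (chartAt ℂ y) y :=
  have : IsManifold 𝓘(ℂ) 1 D.Normalization := IsManifold.of_le (n := ω) le_top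
  (mdifferentiable_chart (I := 𝓘(ℂ)) y).mdifferentiableAt (mem_chart_source ℂ y)

theorem mdifferentiable_fst :
    MDifferentiable 𝓘(ℂ) 𝓘(ℂ) (fun y : D.Normalization => (D.toPullback y).fst) := by
  intro y
  have ht := D.pow_mem_fst_target ((chartAt ℂ y).map_source (mem_chart_source ℂ y))
  have h₁ : MDifferentiableAt 𝓘(ℂ) 𝓘(ℂ)
      (fun u : ℂ => (D.fst (D.toPullback y).fst).chart.symm (u ^ fstOrder (D.toPullback y)))
      (chartAt ℂ y y) := by
    refine MDifferentiableAt.comp (I' := 𝓘(ℂ)) (f := fun u : ℂ => u ^ fstOrder (D.toPullback y)) _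
      ((D.fst _).mdifferentiable.mdifferentiableAt_symm ht) ?_
    exact DifferentiableAt.mdifferentiableAt (by fun_prop)
  refine (h₁.comp y (D.mdifferentiableAt_chartAt y)).congr_of_eventuallyEq ?_
  filter_upwards [(chartAt ℂ y).open_source.mem_nhds (mem_chart_source ℂ y)] with x hx
  have := D.chart_toPullback_fst hx
  change _ = (D.fst _).chart.symm (chartAt ℂ y x ^ _)
  rw [← this.2, (D.fst _).chart.left_inv this.1]

theorem mdifferentiable_snd :
    MDifferentiable 𝓘(ℂ) 𝓘(ℂ) (fun y : D.Normalization => (D.toPullback y).snd) := by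
  intro y
  have ht := D.scale_mul_pow_mem_snd_target ((chartAt ℂ y).map_source (mem_chart_source ℂ y))
  have h₁ : MDifferentiableAt 𝓘(ℂ) 𝓘(ℂ)
      (fun u : ℂ => (D.snd (D.toPullback y).snd).chart.symm
        (D.scale y * u ^ sndOrder (D.toPullback y))) (chartAt ℂ y y) := by
    refine MDifferentiableAt.comp (I' := 𝓘(ℂ))
      (f := fun u : ℂ => D.scale y * u ^ sndOrder (D.toPullback y)) _
      ((D.snd _).mdifferentiable.mdifferentiableAt_symm ht) ?_
    exact DifferentiableAt.mdifferentiableAt (by fun_prop)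
  refine (h₁.comp y (D.mdifferentiableAt_chartAt y)).congr_of_eventuallyEq ?_
  filter_upwards [(chartAt ℂ y).open_source.mem_nhds (mem_chart_source ℂ y)] with x hx
  have := D.chart_toPullback_snd hx
  change _ = (D.snd _).chart.symm (D.scale y * chartAt ℂ y x ^ _)
  rw [← this.2, (D.snd _).chart.left_inv this.1]

theorem continuous_toPullback : Continuous D.toPullback :=
  Continuous.subtype_mk
    (D.mdifferentiable_fst.continuous.prodMk D.mdifferentiable_snd.continuous) _

theorem surjective_toPullback : Function.Surjective D.toPullback :=
  fun x => ⟨(⟨x, 1, one_pow _⟩ : BranchPoint β₁ β₂), rfl⟩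

/-- The number of branches through a point is the greatest common divisor of the local orders. -/
theorem bijOn_root (x : Function.Pullback β₁ β₂) :
    Set.BijOn (fun y : D.Normalization => BranchPoint.root y) (D.toPullback ⁻¹' {x})
      ↑(Polynomial.nthRootsFinset (Nat.gcd (localOrder β₁ x.fst) (localOrder β₂ x.snd)) (1 : ℂ)) := by
  refine ⟨?_, ?_, ?_⟩
  · rintro y rfl
    exact (Polynomial.mem_nthRootsFinset (D.gcd_pos _) _).2 (BranchPoint.root_pow y)
  · rintro y hy y' hy' h
    exact BranchPoint.ext (hy.trans hy'.symm) h
  · intro ξ hξ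
    exact ⟨(⟨x, ξ, (Polynomial.mem_nthRootsFinset (D.gcd_pos _) _).1 hξ⟩ : BranchPoint β₁ β₂),
      rfl, rfl⟩

theorem finite_fiber (x : Function.Pullback β₁ β₂) : (D.toPullback ⁻¹' {x}).Finite :=
  Set.Finite.of_injOn (D.bijOn_root x).mapsTo (D.bijOn_root x).injOn (Finset.finite_toSet _)

theorem ncard_fiber (x : Function.Pullback β₁ β₂) : (D.toPullback ⁻¹' {x}).ncard =
    Nat.gcd (localOrder β₁ x.fst) (localOrder β₂ x.snd) := by
  have := (D.bijOn_root x).image_eq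
  rw [← (D.bijOn_root x).injOn.ncard_image, this, Set.ncard_coe_finset]
  exact (Complex.isPrimitiveRoot_exp _ (D.gcd_pos x).ne').card_nthRootsFinset

/-- A fiber with several points requires both coordinates to be ramified, and ramification points
are isolated in compact surfaces. -/
theorem finite_identified [CompactSpace S₁] [CompactSpace S₂] :
    {x | (D.toPullback ⁻¹' {x}).Nontrivial}.Finite := by
  have h₁ : {z | localOrder β₁ z ≠ 1}.Finite :=
    Set.finite_of_eventually_punctured_notMem fun z => by
      filter_upwards [(D.fst z).chart.open_source.mem_nhds (D.fst z).mem_source] with y hy hyz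
      simpa using D.fst_eq_one z y hy hyz
  have h₂ : {z | localOrder β₂ z ≠ 1}.Finite :=
    Set.finite_of_eventually_punctured_notMem fun z => by
      filter_upwards [(D.snd z).chart.open_source.mem_nhds (D.snd z).mem_source] with y hy hyz
      simpa using D.snd_eq_one z y hy hyz
  refine ((h₁.prod h₂).preimage Subtype.val_injective.injOn).subset ?_
  rintro x ⟨y, rfl, y', hy', hne⟩
  refine ⟨fun h => hne ?_, fun h => hne ?_⟩
  · exact D.eq_of_toPullback_eq hy'.symm (by
      rw [show localOrder β₁ (D.toPullback y).fst = 1 from h, Nat.gcd_one_left])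
  · exact D.eq_of_toPullback_eq hy'.symm (by
      rw [show localOrder β₂ (D.toPullback y).snd = 1 from h, Nat.gcd_one_right])

instance [T2Space S₁] [T2Space S₂] : T2Space D.Normalization := by
  rw [t2Space_iff]
  intro y y' hne
  by_cases h : D.toPullback y = D.toPullback y'
  · exact ⟨_, _, (chartAt ℂ y).open_source, (chartAt ℂ y').open_source, mem_chart_source ℂ y,
      mem_chart_source ℂ y', D.disjoint_source h hne⟩
  · obtain ⟨U, V, hU, hV, hyU, hyV, hd⟩ := t2_separation h
    exact ⟨_, _, hU.preimage D.continuous_toPullback, hV.preimage D.continuous_toPullback, hyU, hyV,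
      hd.preimage _⟩

/-- Over a neighbourhood of x, the space R is covered by the closed half-radius discs around the
finitely many points above x; finitely many such neighbourhoods cover X. -/
theorem compactSpace [CompactSpace (Function.Pullback β₁ β₂)] : CompactSpace D.Normalization := by
  have hloc : ∀ x : Function.Pullback β₁ β₂, ∃ U ∈ 𝓝 x, ∃ K : Set D.Normalization, IsCompact K ∧
      D.toPullback ⁻¹' U ⊆ K := by
    intro x
    have hs : 0 < D.radius x / 2 := half_pos (D.radius_pos x)
    have hs' : D.radius x / 2 < D.radius x := half_lt_self (D.radius_pos x)
    have hfst : Continuous (fun y : Function.Pullback β₁ β₂ => y.fst) :=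
      continuous_fst.comp continuous_subtype_val
    have hsnd : Continuous (fun y : Function.Pullback β₁ β₂ => y.snd) :=
      continuous_snd.comp continuous_subtype_val
    have hnorm : ∀ᶠ z in 𝓝 x.fst,
        ‖(D.fst x.fst).chart z‖ < (D.radius x / 2) ^ fstOrder x := by
      have hc := ((D.fst x.fst).chart.continuousAt (D.fst x.fst).mem_source).norm
      refine hc.eventually_lt continuousAt_const ?_
      rw [PowerChart.chart_self, norm_zero]
      exact pow_pos hs _
    refine ⟨_, Filter.inter_mem (hfst.continuousAt.preimage_mem_nhds
      ((D.fst x.fst).chart.open_source.mem_nhds (D.fst x.fst).mem_source))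
      (Filter.inter_mem (hsnd.continuousAt.preimage_mem_nhds
      ((D.snd x.snd).chart.open_source.mem_nhds (D.snd x.snd).mem_source))
      (hfst.continuousAt.preimage_mem_nhds hnorm)),
      ⋃ y ∈ D.toPullback ⁻¹' {x}, D.param y '' Metric.closedBall 0 (D.radius x / 2), ?_, ?_⟩
    · refine (D.finite_fiber x).isCompact_biUnion ?_
      rintro y rfl
      refine (isCompact_closedBall _ _).image_of_continuousOn ?_
      refine (chartAt ℂ y).continuousOn_symm.mono ?_
      exact Metric.closedBall_subset_ball hs'
    · rintro y ⟨h₁, h₂, h₃⟩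
      obtain ⟨y', hy', u, hu, rfl⟩ := D.exists_param_eq x y h₁ h₂ hs hs'.le h₃
      exact Set.mem_biUnion hy' ⟨u, by simpa using hu.le, rfl⟩
  choose U hU K hK hUK using hloc
  obtain ⟨t, -, ht⟩ := (isCompact_univ (X := Function.Pullback β₁ β₂)).elim_nhds_subcover U
    (fun x _ => hU x)
  refine ⟨(t.isCompact_biUnion fun x _ => hK x).of_isClosed_subset isClosed_univ ?_⟩
  intro y _
  obtain ⟨x, hx, hxy⟩ := Set.mem_iUnion₂.1 (ht (Set.mem_univ (D.toPullback y)))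
  exact Set.mem_biUnion hx (hUK x hxy)

theorem isQuotientMap_toPullback [CompactSpace D.Normalization] [T2Space S₁] [T2Space S₂] :
    Topology.IsQuotientMap D.toPullback :=
  D.continuous_toPullback.isClosedMap.isQuotientMap D.continuous_toPullback D.surjective_toPullback

end FiberProductCharts
end BranchPoint

theorem compactSpace_pullback {X Y Z : Type*} [TopologicalSpace X] [TopologicalSpace Y]
    [TopologicalSpace Z] [CompactSpace X] [CompactSpace Y] [T2Space Z] {f : X → Z} {g : Y → Z}
    (hf : Continuous f) (hg : Continuous g) : CompactSpace (Function.Pullback f g) :=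
  isCompact_iff_compactSpace.1
    (isClosed_eq (hf.comp continuous_fst) (hg.comp continuous_snd)).isCompact

/-! ### Weighted fiber counts of branched maps. -/

theorem finsum_mem_const_nat {X : Type*} {s : Set X} (hs : s.Finite) (k : ℕ) :
    ∑ᶠ _x ∈ s, k = s.ncard * k := by
  rw [finsum_mem_eq_finite_toFinset_sum _ hs, Finset.sum_const, smul_eq_mul,
    Set.ncard_eq_toFinset_card _ hs]

theorem Complex.ncard_pow_eq {a : ℕ} (ha : a ≠ 0) {t : ℂ} (ht : t ≠ 0) :
    {u : ℂ | u ^ a = t}.Finite ∧ {u : ℂ | u ^ a = t}.ncard = a := by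
  have h₀ := Complex.cpow_nat_inv_pow t ha
  set u₀ := t ^ ((a : ℂ)⁻¹)
  have hu₀ : u₀ ≠ 0 := by
    intro h
    rw [h, zero_pow ha] at h₀
    exact ht h₀.symm
  have himg : {u : ℂ | u ^ a = t} = (u₀ * ·) '' ↑(Polynomial.nthRootsFinset a (1 : ℂ)) := by
    ext u
    constructor
    · intro hu
      refine ⟨u / u₀, ?_, mul_div_cancel₀ _ hu₀⟩
      rw [Finset.mem_coe, Polynomial.mem_nthRootsFinset (Nat.pos_of_ne_zero ha), div_pow, h₀,
        show u ^ a = t from hu, div_self ht]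
    · rintro ⟨v, hv, rfl⟩
      rw [Finset.mem_coe, Polynomial.mem_nthRootsFinset (Nat.pos_of_ne_zero ha)] at hv
      change (u₀ * v) ^ a = t
      rw [mul_pow, hv, mul_one, h₀]
  rw [himg]
  refine ⟨(Finset.finite_toSet _).image _, ?_⟩
  rw [(mul_right_injective₀ hu₀).injOn.ncard_image, Set.ncard_coe_finset]
  exact (Complex.isPrimitiveRoot_exp _ ha).card_nthRootsFinset

section Branched

variable {X Y : Type*} [TopologicalSpace X] [TopologicalSpace Y]

/-- Near `p`, the map `f` is `t ↦ c * t ^ w p` in suitable local coordinates, and the weight `w`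
is one at nearby points. -/
def IsBranchedAt (f : X → Y) (w : X → ℕ) (p : X) : Prop :=
  ∃ (e : OpenPartialHomeomorph X ℂ) (e' : OpenPartialHomeomorph Y ℂ) (c : ℂ), p ∈ e.source ∧
    e p = 0 ∧ c ≠ 0 ∧ w p ≠ 0 ∧
    (∀ y ∈ e.source, f y ∈ e'.source ∧ e' (f y) = e' (f p) + c * e y ^ w p) ∧
    ∀ y ∈ e.source, y ≠ p → w y = 1

/-- Near `p`, fibers of `f` have constant total weight. -/
def IsBalancedAt (f : X → Y) (w : X → ℕ) (p : X) : Prop :=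
  ∀ U ∈ 𝓝 p, ∃ V ∈ 𝓝 p, V ⊆ U ∧ ∀ᶠ z in 𝓝 (f p), ∑ᶠ y ∈ V ∩ f ⁻¹' {z}, w y = w p

variable {f : X → Y} {w : X → ℕ}

/-- The equation c u^n = s has either the single solution 0, of weight n, or n distinct solutions,
each of weight 1. -/
theorem IsBranchedAt.isBalancedAt {p : X} (h : IsBranchedAt f w p) : IsBalancedAt f w p := by
  obtain ⟨e, e', c, hp, hp0, hc, ha, hf, hw⟩ := h
  intro U hU
  have h0 : (0 : ℂ) ∈ e.target := hp0 ▸ e.map_source hp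
  have hsymm : e.symm 0 = p := by rw [← hp0, e.left_inv hp]
  have hnhds : e.target ∩ e.symm ⁻¹' U ∈ 𝓝 (0 : ℂ) := by
    refine Filter.inter_mem (e.open_target.mem_nhds h0) ((e.continuousAt_symm h0) ?_)
    rwa [hsymm]
  obtain ⟨ε, hε, hεU⟩ := Metric.mem_nhds_iff.1 hnhds
  refine ⟨e.source ∩ e ⁻¹' Metric.ball 0 ε, ?_, ?_, ?_⟩
  · refine Filter.inter_mem (e.open_source.mem_nhds hp) ((e.continuousAt hp) ?_)
    rw [hp0]
    exact Metric.ball_mem_nhds 0 hε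
  · rintro y ⟨hy, hyε⟩
    have := (hεU hyε).2
    rwa [Set.mem_preimage, e.left_inv hy] at this
  have hfp := (hf p hp).1
  -- This bound puts every n-th root of the target value inside the ball of radius ε.
  have hsmall : ∀ᶠ z in 𝓝 (f p), ‖(e' z - e' (f p)) / c‖ < ε ^ w p := by
    have hcont : ContinuousAt (fun z => ‖(e' z - e' (f p)) / c‖) (f p) :=
      (((e'.continuousAt hfp).sub continuousAt_const).div_const c).norm
    refine hcont.eventually_lt continuousAt_const ?_
    simpa using pow_pos hε _
  filter_upwards [hsmall, e'.open_source.mem_nhds hfp] with z hz hze'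
  set t := (e' z - e' (f p)) / c with ht
  have hmem : ∀ y ∈ e.source, f y = z ↔ e y ^ w p = t := by
    intro y hy
    rw [← e'.injOn.eq_iff (hf y hy).1 hze', (hf y hy).2, ht, eq_div_iff hc, eq_sub_iff_add_eq',
      mul_comm c]
  rcases eq_or_ne t 0 with h0' | h0'
  · have hset : (e.source ∩ e ⁻¹' Metric.ball 0 ε) ∩ f ⁻¹' {z} = {p} := by
      ext y
      constructor
      · rintro ⟨⟨hy, -⟩, hyz⟩
        have := (hmem y hy).1 hyz
        rw [h0', pow_eq_zero_iff ha, ← hp0] at this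
        exact e.injOn hy hp this
      · rintro rfl
        refine ⟨⟨hp, ?_⟩, (hmem _ hp).2 ?_⟩
        · rw [Set.mem_preimage, hp0]; exact Metric.mem_ball_self hε
        · rw [hp0, zero_pow ha, h0']
    rw [hset, finsum_mem_singleton]
  · have hbij : Set.BijOn e ((e.source ∩ e ⁻¹' Metric.ball 0 ε) ∩ f ⁻¹' {z})
        {u : ℂ | u ^ w p = t} := by
      refine ⟨fun y hy => (hmem y hy.1.1).1 hy.2, e.injOn.mono fun y hy => hy.1.1, ?_⟩
      intro u hu
      have huε : u ∈ Metric.ball (0 : ℂ) ε := by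
        rw [← show u ^ w p = t from hu, norm_pow] at hz
        rw [mem_ball_zero_iff]
        exact lt_of_pow_lt_pow_left₀ _ hε.le hz
      have hut := (hεU huε).1
      refine ⟨e.symm u, ⟨⟨e.map_target hut, ?_⟩, (hmem _ (e.map_target hut)).2 ?_⟩,
        e.right_inv hut⟩
      · rwa [Set.mem_preimage, e.right_inv hut]
      · rwa [e.right_inv hut]
    obtain ⟨hfin, hcard⟩ := Complex.ncard_pow_eq ha h0'
    have hone : ∑ᶠ y ∈ (e.source ∩ e ⁻¹' Metric.ball 0 ε) ∩ f ⁻¹' {z}, w y =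
        ∑ᶠ u ∈ {u : ℂ | u ^ w p = t}, 1 := by
      refine finsum_mem_eq_of_bijOn e hbij fun y hy => hw y hy.1.1 ?_
      rintro rfl
      have := (hmem _ hp).1 hy.2
      rw [hp0, zero_pow ha] at this
      exact h0' this.symm
    rw [hone, finsum_mem_const_nat hfin, hcard, mul_one]

theorem finite_fiber_of_isBranchedAt [CompactSpace X] [T1Space Y] (hf : Continuous f)
    (h : ∀ p, IsBranchedAt f w p) (z : Y) : (f ⁻¹' {z}).Finite := by
  refine Set.finite_of_eventually_punctured_notMem fun p => ?_
  rcases eq_or_ne (f p) z with rfl | hne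
  · obtain ⟨e, e', c, hp, hp0, hc, ha, hf, hw⟩ := h p
    filter_upwards [e.open_source.mem_nhds hp] with y hy hyp hyz
    have := (hf y hy).2
    rw [show f y = f p from hyz, left_eq_add, mul_eq_zero, or_iff_right hc,
      pow_eq_zero_iff ha, ← hp0] at this
    exact hyp (e.injOn hy hp this)
  · filter_upwards [hf.continuousAt.eventually_ne hne] with y hy _
    exact hy

/-- The total weight of the fibers of a balanced map is locally constant. -/
theorem isLocallyConstant_finsum_fiber [CompactSpace X] [T2Space X] [T2Space Y] (hf : Continuous f)
    (hfin : ∀ z, (f ⁻¹' {z}).Finite) (h : ∀ p, IsBalancedAt f w p) :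
    IsLocallyConstant fun z => ∑ᶠ y ∈ f ⁻¹' {z}, w y := by
  rw [IsLocallyConstant.iff_eventually_eq]
  intro z₀
  obtain ⟨U, hU, hUd⟩ := (hfin z₀).t2_separation
  choose V hV hVU hVw using fun p => h p (U p) ((hU p).2.mem_nhds (hU p).1)
  -- The image of K is closed and misses z₀, so fibers over nearby points lie entirely in the chosen
  -- neighbourhoods.
  let K : Set X := (⋃ p ∈ f ⁻¹' {z₀}, interior (V p))ᶜ
  have hK : IsClosed K := (isOpen_biUnion fun p _ => isOpen_interior).isClosed_compl
  have hz₀ : z₀ ∉ f '' K := by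
    rintro ⟨p, hpK, hp⟩
    exact hpK (Set.mem_biUnion hp (mem_interior_iff_mem_nhds.2 (hV p)))
  have hev : ∀ᶠ z in 𝓝 z₀, ∀ p ∈ f ⁻¹' {z₀}, ∑ᶠ y ∈ V p ∩ f ⁻¹' {z}, w y = w p :=
    (Filter.eventually_all_finite (hfin z₀)).2 fun p hp => by
      have := hVw p
      rwa [show f p = z₀ from hp] at this
  filter_upwards [(hf.isClosedMap K hK).isOpen_compl.mem_nhds hz₀, hev] with z hz hzw
  have hset : f ⁻¹' {z} = ⋃ p ∈ f ⁻¹' {z₀}, (V p ∩ f ⁻¹' {z}) := by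
    ext y
    refine ⟨fun hy => ?_, fun hy => ?_⟩
    · have hyK : y ∉ K := fun hyK => hz ⟨y, hyK, hy⟩
      obtain ⟨p, hp, hyp⟩ := Set.mem_iUnion₂.1 (not_not.1 hyK)
      exact Set.mem_biUnion hp ⟨interior_subset hyp, hy⟩
    · obtain ⟨p, -, hyp⟩ := Set.mem_iUnion₂.1 hy
      exact hyp.2
  rw [hset, finsum_mem_biUnion _ (hfin z₀) fun p _ => (hfin z).subset Set.inter_subset_right]
  · exact finsum_mem_congr rfl hzw
  · exact hUd.mono fun p => Set.inter_subset_left.trans (hVU p)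

/-- A neighbourhood can be shrunk to lie inside C or off C, where the weight vanishes. This gives
each clopen piece its own degree. -/
theorem IsBalancedAt.indicator {C : Set X} (hC : IsClopen C) {p : X} (h : IsBalancedAt f w p) :
    IsBalancedAt f (C.indicator w) p := by
  intro U hU
  by_cases hp : p ∈ C
  · obtain ⟨V, hV, hVU, hw⟩ := h (U ∩ C) (Filter.inter_mem hU (hC.isOpen.mem_nhds hp))
    refine ⟨V, hV, hVU.trans Set.inter_subset_left, ?_⟩
    filter_upwards [hw] with z hz
    rw [Set.indicator_of_mem hp, ← hz]
    exact finsum_mem_congr rfl fun y hy => Set.indicator_of_mem (hVU hy.1).2 _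
  · refine ⟨U ∩ Cᶜ, Filter.inter_mem hU (hC.isClosed.isOpen_compl.mem_nhds hp),
      Set.inter_subset_left, Filter.Eventually.of_forall fun z => ?_⟩
    rw [Set.indicator_of_notMem hp]
    exact finsum_mem_eq_zero_of_forall_eq_zero fun y hy => Set.indicator_of_notMem hy.1.2 _

end Branched

/-- Total weights of fibers are multiplicative under composition. -/
theorem finsum_fiber_comp {X Y Z : Type*} {f : X → Y} {g : Y → Z} (hf : ∀ y, (f ⁻¹' {y}).Finite)
    {q : Z} (hg : (g ⁻¹' {q}).Finite) (a : Y → ℕ) (b : X → ℕ) {d : ℕ}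
    (hd : ∀ y, ∑ᶠ x ∈ f ⁻¹' {y}, b x = d) :
    ∑ᶠ x ∈ (fun x => g (f x)) ⁻¹' {q}, a (f x) * b x = (∑ᶠ y ∈ g ⁻¹' {q}, a y) * d := by
  have hset : (fun x => g (f x)) ⁻¹' {q} = ⋃ y ∈ g ⁻¹' {q}, f ⁻¹' {y} := by
    ext x; simp
  rw [hset, finsum_mem_biUnion _ hg fun y _ => hf y]
  · rw [finsum_mem_mul]
    refine finsum_mem_congr rfl fun y _ => ?_
    rw [← hd y, mul_finsum_mem]
    exact finsum_mem_congr rfl fun x hx => by rw [show f x = y from hx]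
  · intro y _ y' _ hne
    exact Disjoint.preimage _ (Set.disjoint_singleton.2 hne)

/-! ### Degrees over the two factors and connectedness for coprime degrees. -/

section BranchPoint

variable {S₁ S₂ S₀ : Type*} [TopologicalSpace S₁] [ChartedSpace ℂ S₁] [TopologicalSpace S₂]
  [ChartedSpace ℂ S₂] [TopologicalSpace S₀] [ChartedSpace ℂ S₀]

theorem PowerChart.isBranchedAt {β : S₁ → S₀} {z : S₁} (P : PowerChart β z)
    (h0 : localOrder β z ≠ 0) (h1 : ∀ y ∈ P.chart.source, y ≠ z → localOrder β y = 1) :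
    IsBranchedAt β (localOrder β) z :=
  ⟨P.chart, chartAt ℂ (β z), 1, P.mem_source, P.chart_self, one_ne_zero, h0,
    fun y hy => ⟨P.mapsTo y hy, by rw [P.apply_eq y hy, one_mul]⟩, h1⟩

/-- All fibers have the same number of points, counted with multiplicity. -/
theorem fiberDegree_eq_mapDegree [CompactSpace S₁] [T2Space S₁] [T2Space S₀] [Nonempty S₀]
    [PreconnectedSpace S₀] {β : S₁ → S₀} (hβ : Continuous β)
    (h : ∀ z, IsBranchedAt β (localOrder β) z) (q : S₀) : fiberDegree β q = mapDegree β :=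
  (isLocallyConstant_finsum_fiber hβ (finite_fiber_of_isBranchedAt hβ h)
    fun p => (h p).isBalancedAt).apply_eq_of_preconnectedSpace q _

namespace FiberProductCharts

variable {β₁ : S₁ → S₀} {β₂ : S₂ → S₀} (D : FiberProductCharts β₁ β₂)

theorem isBranchedAt_fst (y : D.Normalization) : IsBranchedAt
    (fun y : D.Normalization => (D.toPullback y).fst) (fun y => fstOrder (D.toPullback y)) y := by
  refine ⟨chartAt ℂ y, (D.fst (D.toPullback y).fst).chart, 1, mem_chart_source ℂ y,
    D.chartAt_self y, one_ne_zero, D.fstOrder_ne_zero _, fun x hx => ?_, fun x hx hxy => ?_⟩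
  · rw [PowerChart.chart_self, zero_add, one_mul]
    exact D.chart_toPullback_fst hx
  · obtain ⟨h₁, h₂⟩ := D.orders_of_mem_source hx hxy
    simp [fstOrder, h₁, h₂]

theorem isBranchedAt_snd (y : D.Normalization) : IsBranchedAt
    (fun y : D.Normalization => (D.toPullback y).snd) (fun y => sndOrder (D.toPullback y)) y := by
  refine ⟨chartAt ℂ y, (D.snd (D.toPullback y).snd).chart, D.scale y, mem_chart_source ℂ y,
    D.chartAt_self y, D.scale_ne_zero y, D.sndOrder_ne_zero _, fun x hx => ?_, fun x hx hxy => ?_⟩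
  · rw [PowerChart.chart_self, zero_add]
    exact D.chart_toPullback_snd hx
  · obtain ⟨h₁, h₂⟩ := D.orders_of_mem_source hx hxy
    simp [sndOrder, h₁, h₂]

/-- The degree of the normalization over the first factor. -/
theorem finsum_fstOrder (hfin : ∀ q, (β₂ ⁻¹' {q}).Finite) (z : S₁) :
    ∑ᶠ y ∈ (fun y : D.Normalization => (D.toPullback y).fst) ⁻¹' {z}, fstOrder (D.toPullback y) =
      fiberDegree β₂ (β₁ z) := by
  have hbij : Set.BijOn (fun x : Function.Pullback β₁ β₂ => x.snd)
      {x : Function.Pullback β₁ β₂ | x.fst = z} (β₂ ⁻¹' {β₁ z}) := by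
    refine ⟨?_, ?_, ?_⟩
    · rintro x rfl
      exact x.2.symm
    · intro x hx x' hx' h
      exact Function.Pullback.ext (hx.trans hx'.symm) h
    · intro z₂ hz₂
      exact ⟨⟨(z, z₂), hz₂.symm⟩, rfl, rfl⟩
  have hfin' : {x : Function.Pullback β₁ β₂ | x.fst = z}.Finite :=
    Set.Finite.of_injOn hbij.mapsTo hbij.injOn (hfin _)
  have hset : (fun y : D.Normalization => (D.toPullback y).fst) ⁻¹' {z} =
      ⋃ x ∈ {x : Function.Pullback β₁ β₂ | x.fst = z}, D.toPullback ⁻¹' {x} := by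
    ext y; simp
  rw [hset, finsum_mem_biUnion _ hfin' fun x _ => D.finite_fiber x, fiberDegree]
  · refine finsum_mem_eq_of_bijOn _ hbij fun x _ => ?_
    -- The g branches over a point of X have order n/g each, so together they contribute n.
    rw [← fstOrder_mul_gcd, ← D.ncard_fiber x, mul_comm, ← finsum_mem_const_nat (D.finite_fiber x)]
    exact finsum_mem_congr rfl fun y hy => by rw [show D.toPullback y = x from hy]
  · intro y _ y' _ hne
    exact Disjoint.preimage _ (Set.disjoint_singleton.2 hne)

theorem preconnectedSpace_of_coprime [CompactSpace S₁] [CompactSpace S₂] [T2Space S₁] [T2Space S₂]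
    [T2Space S₀] [ConnectedSpace S₁] [PreconnectedSpace S₂] [ConnectedSpace S₀]
    [CompactSpace D.Normalization] (hβ₁ : Continuous β₁) (hβ₂ : Continuous β₂)
    (hgcd : Nat.gcd (mapDegree β₁) (mapDegree β₂) = 1) : PreconnectedSpace D.Normalization := by
  have hb₁ : ∀ z, IsBranchedAt β₁ (localOrder β₁) z := fun z =>
    (D.fst z).isBranchedAt (D.fst_ne_zero z) (D.fst_eq_one z)
  have hb₂ : ∀ z, IsBranchedAt β₂ (localOrder β₂) z := fun z =>
    (D.snd z).isBranchedAt (D.snd_ne_zero z) (D.snd_eq_one z)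
  have hfin₁ := finite_fiber_of_isBranchedAt hβ₁ hb₁
  have hfin₂ := finite_fiber_of_isBranchedAt hβ₂ hb₂
  have hcf := D.mdifferentiable_fst.continuous
  have hcs := D.mdifferentiable_snd.continuous
  have hfinf := finite_fiber_of_isBranchedAt hcf D.isBranchedAt_fst
  have hfins := finite_fiber_of_isBranchedAt hcs D.isBranchedAt_snd
  let wf : D.Normalization → ℕ := fun y => fstOrder (D.toPullback y)
  let ws : D.Normalization → ℕ := fun y => sndOrder (D.toPullback y)
  have hd : ∀ C : Set D.Normalization, IsClopen C → ∃ d, ∀ z,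
      ∑ᶠ y ∈ (fun y : D.Normalization => (D.toPullback y).fst) ⁻¹' {z}, C.indicator wf y = d :=
    fun C hC => ⟨_, fun z => (isLocallyConstant_finsum_fiber hcf hfinf fun p =>
      (D.isBranchedAt_fst p).isBalancedAt.indicator hC).apply_eq_of_preconnectedSpace z
        (Classical.arbitrary S₁)⟩
  have hdvd : ∀ C : Set D.Normalization, IsClopen C → ∀ d, (∀ z,
      ∑ᶠ y ∈ (fun y : D.Normalization => (D.toPullback y).fst) ⁻¹' {z}, C.indicator wf y = d) →
      mapDegree β₂ ∣ d := by
    intro C hC d hd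
    -- A point of S₂ is needed as base point for the degree over S₂; without one, R is empty and d
    -- is 0.
    rcases isEmpty_or_nonempty S₂ with hS₂ | ⟨⟨z₂⟩⟩
    · have : IsEmpty D.Normalization := ⟨fun y => hS₂.false (D.toPullback y).snd⟩
      rw [← hd (Classical.arbitrary S₁), finsum_mem_eq_zero_of_forall_eq_zero]
      · exact dvd_zero _
      · exact fun y => isEmptyElim y
    have he := fun z => (isLocallyConstant_finsum_fiber hcs hfins fun p =>
      (D.isBranchedAt_snd p).isBalancedAt.indicator hC).apply_eq_of_preconnectedSpace z z₂
    have h₁ := finsum_fiber_comp hfinf (hfin₁ (β₂ z₂)) (localOrder β₁) _ hd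
    have h₂ := finsum_fiber_comp hfins (hfin₂ (β₂ z₂)) (localOrder β₂) _ he
    have hset : (fun y : D.Normalization => β₁ (D.toPullback y).fst) ⁻¹' {β₂ z₂} =
        (fun y : D.Normalization => β₂ (D.toPullback y).snd) ⁻¹' {β₂ z₂} := by
      ext y
      rw [Set.mem_preimage, Set.mem_preimage, show β₁ (D.toPullback y).fst = _ from
        (D.toPullback y).2]
      rfl
    -- On C both products are the local order of the branch over S₀, computed through either factor:
    -- m a = n b.
    have hsum : ∀ y : D.Normalization, localOrder β₁ (D.toPullback y).fst * C.indicator wf y =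
        localOrder β₂ (D.toPullback y).snd * C.indicator ws y := by
      intro y
      by_cases hy : y ∈ C
      · rw [Set.indicator_of_mem hy, Set.indicator_of_mem hy]
        exact localOrder_mul_fstOrder _
      · rw [Set.indicator_of_notMem hy, Set.indicator_of_notMem hy]
        rfl
    have h₃ : fiberDegree β₁ (β₂ z₂) * d = fiberDegree β₂ (β₂ z₂) * _ :=
      h₁.symm.trans ((finsum_mem_congr hset fun y _ => hsum y).trans h₂)
    rw [fiberDegree_eq_mapDegree hβ₁ hb₁, fiberDegree_eq_mapDegree hβ₂ hb₂] at h₃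
    exact (Nat.Coprime.symm hgcd).dvd_of_dvd_mul_left ⟨_, h₃⟩
  have hempty : ∀ C : Set D.Normalization, (∀ z,
      ∑ᶠ y ∈ (fun y : D.Normalization => (D.toPullback y).fst) ⁻¹' {z}, C.indicator wf y = 0) →
      C = ∅ := by
    intro C h
    refine Set.eq_empty_of_forall_notMem fun y hy => ?_
    have h0 := h (D.toPullback y).fst
    rw [finsum_mem_eq_finite_toFinset_sum _ (hfinf _), Finset.sum_eq_zero_iff] at h0
    have := h0 y (by simp)
    rw [Set.indicator_of_mem hy] at this
    exact D.fstOrder_ne_zero _ this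
  rw [preconnectedSpace_iff_clopen]
  intro C hC
  obtain ⟨d, hdC⟩ := hd C hC
  obtain ⟨d', hdC'⟩ := hd Cᶜ hC.compl
  -- The degrees of C and its complement add up to the degree of R over S₁.
  have htot : d + d' = mapDegree β₂ := by
    rw [← fiberDegree_eq_mapDegree hβ₂ hb₂ (β₁ (Classical.arbitrary S₁)),
      ← D.finsum_fstOrder hfin₂, ← hdC (Classical.arbitrary S₁), ← hdC' (Classical.arbitrary S₁),
      ← finsum_mem_add_distrib (hfinf _)]
    exact finsum_mem_congr rfl fun y _ => Set.indicator_self_add_compl_apply C wf y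
  rcases Nat.eq_zero_or_pos d with rfl | hd0
  · exact Or.inl (hempty C hdC)
  · refine Or.inr ?_
    -- A positive multiple of deg β₂ is at least deg β₂, leaving nothing for the complement.
    have := Nat.le_of_dvd hd0 (hdvd C hC d hdC)
    have hd' : d' = 0 := by omega
    subst hd'
    exact Set.compl_empty_iff.1 (hempty Cᶜ hdC')

end FiberProductCharts
end BranchPoint

/-! ### Transport of complex structures along homeomorphisms. -/

/-- A charted space structure transported along a homeomorphism. -/
@[reducible]
def Homeomorph.transportChartedSpace {X Y H : Type*} [TopologicalSpace X] [TopologicalSpace Y]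
    [TopologicalSpace H] [ChartedSpace H X] (h : X ≃ₜ Y) : ChartedSpace H Y where
  atlas := (fun e => h.symm.toOpenPartialHomeomorph.trans e) '' atlas H X
  chartAt y := h.symm.toOpenPartialHomeomorph.trans (chartAt H (h.symm y))
  mem_chart_source y := ⟨trivial, mem_chart_source H (h.symm y)⟩
  chart_mem_atlas y := ⟨_, chart_mem_atlas H (h.symm y), rfl⟩

/-- The homeomorphism cancels in every transition map, so the transported transitions are the old
ones. -/
theorem Homeomorph.hasGroupoid_transport {X Y H : Type*} [TopologicalSpace X] [TopologicalSpace Y]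
    [TopologicalSpace H] [ChartedSpace H X] (h : X ≃ₜ Y) (G : StructureGroupoid H)
    [HasGroupoid X G] : @HasGroupoid H _ Y _ h.transportChartedSpace G := by
  let := h.transportChartedSpace (H := H)
  refine ⟨?_⟩
  rintro _ _ ⟨e, he, rfl⟩ ⟨e', he', rfl⟩
  have : (h.symm.toOpenPartialHomeomorph.trans e).symm.trans
      (h.symm.toOpenPartialHomeomorph.trans e') ≈ e.symm.trans e' := by
    refine ⟨?_, ?_⟩
    · ext x
      simp
    · intro x hx
      simp
  exact G.mem_of_eqOnSource (HasGroupoid.compatible he he') this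

theorem Homeomorph.mdifferentiable_symm_transport {X Y : Type*} [TopologicalSpace X]
    [TopologicalSpace Y] [ChartedSpace ℂ X] [IsManifold 𝓘(ℂ) ω X] (h : X ≃ₜ Y) :
    let := h.transportChartedSpace (H := ℂ)
    MDifferentiable 𝓘(ℂ) 𝓘(ℂ) h.symm := by
  intro inst
  have : HasGroupoid Y (contDiffGroupoid ω 𝓘(ℂ)) := h.hasGroupoid_transport _
  have : IsManifold 𝓘(ℂ) ω Y := IsManifold.mk' _ _ _
  have : IsManifold 𝓘(ℂ) 1 X := IsManifold.of_le (n := ω) le_top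
  have : IsManifold 𝓘(ℂ) 1 Y := IsManifold.of_le (n := ω) le_top
  intro y
  have h₁ := (mdifferentiable_chart (I := 𝓘(ℂ)) y).mdifferentiableAt (mem_chart_source ℂ y)
  have h₂ := (mdifferentiable_chart (I := 𝓘(ℂ)) (h.symm y)).mdifferentiableAt_symm
    (mem_chart_target ℂ (h.symm y))
  refine (MDifferentiableAt.comp (f := chartAt ℂ y) y h₂ h₁).congr_of_eventuallyEq ?_
  filter_upwards [(chartAt ℂ y).open_source.mem_nhds (mem_chart_source ℂ y)] with x hx
  exact ((chartAt ℂ (h.symm y)).left_inv hx.2).symm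

/-! ### Fiberwise least common multiples and the main theorem. -/

theorem fiberLcm_dvd {S S₀ : Type*} [TopologicalSpace S] [ChartedSpace ℂ S]
    [TopologicalSpace S₀] [ChartedSpace ℂ S₀] {β : S → S₀} (hfin : ∀ q, (β ⁻¹' {q}).Finite)
    (h0 : ∀ z, localOrder β z ≠ 0) (z : S) : localOrder β z ∣ fiberLcm β (β z) := by
  -- The product of the local orders over the finite fiber is a positive common multiple, so the
  -- infimum is attained.
  have hne : {m : ℕ | 0 < m ∧ ∀ y : S, β y = β z → localOrder β y ∣ m}.Nonempty :=
    ⟨∏ y ∈ (hfin (β z)).toFinset, localOrder β y,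
      Finset.prod_pos fun y _ => Nat.pos_of_ne_zero (h0 y),
      fun y hy => Finset.dvd_prod_of_mem _ (by simpa using hy)⟩
  exact (Nat.sInf_mem hne).2 z rfl

theorem nonempty_fiberProductCharts {S₁ S₂ S₀ : Type*}
    [TopologicalSpace S₁] [ChartedSpace ℂ S₁] [IsManifold 𝓘(ℂ) ω S₁] [PreconnectedSpace S₁]
    [TopologicalSpace S₂] [ChartedSpace ℂ S₂] [IsManifold 𝓘(ℂ) ω S₂] [PreconnectedSpace S₂]
    [TopologicalSpace S₀] [ChartedSpace ℂ S₀] [IsManifold 𝓘(ℂ) ω S₀]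
    {β₁ : S₁ → S₀} {β₂ : S₂ → S₀}
    (hol₁ : MDifferentiable 𝓘(ℂ) 𝓘(ℂ) β₁) (hol₂ : MDifferentiable 𝓘(ℂ) 𝓘(ℂ) β₂)
    (nonconst₁ : ∃ x y, β₁ x ≠ β₁ y) (nonconst₂ : ∃ x y, β₂ x ≠ β₂ y) :
    Nonempty (FiberProductCharts β₁ β₂) := by
  have h₁ := localOrder_ne_zero hol₁ nonconst₁
  have h₂ := localOrder_ne_zero hol₂ nonconst₂
  exact ⟨⟨fun z => (nonempty_powerChart hol₁ (h₁ z)).some,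
    fun z => (nonempty_powerChart hol₂ (h₂ z)).some, h₁, h₂,
    fun z y => PowerChart.localOrder_eq_one hol₁ h₁ _,
    fun z y => PowerChart.localOrder_eq_one hol₂ h₂ _⟩⟩

theorem theorem2p5 {S₁ S₂ S₀ : Type*}
    [TopologicalSpace S₁] [ChartedSpace ℂ S₁] [ClosedRiemannSurface S₁]
    [TopologicalSpace S₂] [ChartedSpace ℂ S₂] [ClosedRiemannSurface S₂]
    [TopologicalSpace S₀] [ChartedSpace ℂ S₀] [ClosedRiemannSurface S₀]
    (β₁ : S₁ → S₀) (β₂ : S₂ → S₀)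
    (hol₁ : MDifferentiable 𝓘(ℂ) 𝓘(ℂ) β₁) (hol₂ : MDifferentiable 𝓘(ℂ) 𝓘(ℂ) β₂)
    (nonconst₁ : ∃ x y, β₁ x ≠ β₁ y) (nonconst₂ : ∃ x y, β₂ x ≠ β₂ y)
    (connected : ConnectedSpace (Function.Pullback β₁ β₂)) :
    ((Nat.gcd (mapDegree β₁) (mapDegree β₂) = 1 ∨
        ∀ q : S₀, Nat.gcd (fiberLcm β₁ q) (fiberLcm β₂ q) = 1) →
      FiberProductIrreducible β₁ β₂) ∧
    ((∀ q : S₀, Nat.gcd (fiberLcm β₁ q) (fiberLcm β₂ q) = 1) →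
      FiberProductIsClosedRiemannSurface β₁ β₂) := by
  obtain ⟨D⟩ := nonempty_fiberProductCharts hol₁ hol₂ nonconst₁ nonconst₂
  have hX : CompactSpace (Function.Pullback β₁ β₂) :=
    compactSpace_pullback hol₁.continuous hol₂.continuous
  have hR : CompactSpace D.Normalization := D.compactSpace
  have hne : Nonempty D.Normalization :=
    connected.toNonempty.map fun x => (D.surjective_toPullback x).choose
  have hquot : Topology.IsQuotientMap D.toPullback := D.isQuotientMap_toPullback
  have hhomeo : (∀ q : S₀, Nat.gcd (fiberLcm β₁ q) (fiberLcm β₂ q) = 1) →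
      ∃ h : D.Normalization ≃ₜ Function.Pullback β₁ β₂, ∀ y, h y = D.toPullback y := by
    intro hq
    have hfin₁ : ∀ q, (β₁ ⁻¹' {q}).Finite := finite_fiber_of_isBranchedAt hol₁.continuous
      fun z => (D.fst z).isBranchedAt (D.fst_ne_zero z) (D.fst_eq_one z)
    have hfin₂ : ∀ q, (β₂ ⁻¹' {q}).Finite := finite_fiber_of_isBranchedAt hol₂.continuous
      fun z => (D.snd z).isBranchedAt (D.snd_ne_zero z) (D.snd_eq_one z)
    -- Local orders at the two coordinates divide the coprime lcm's over their common image, so just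
    -- one branch passes through each point.
    have hinj : Function.Injective D.toPullback := by
      intro y y' h
      refine D.eq_of_toPullback_eq h ?_
      have h₁ := fiberLcm_dvd hfin₁ D.fst_ne_zero (D.toPullback y).fst
      have h₂ := fiberLcm_dvd hfin₂ D.snd_ne_zero (D.toPullback y).snd
      rw [show β₁ (D.toPullback y).fst = β₂ (D.toPullback y).snd from (D.toPullback y).2] at h₁
      exact Nat.Coprime.coprime_dvd_left h₁ (Nat.Coprime.coprime_dvd_right h₂ (hq _))
    exact ⟨D.continuous_toPullback.homeoOfEquivCompactToT2
      (f := Equiv.ofBijective _ ⟨hinj, D.surjective_toPullback⟩), fun _ => rfl⟩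
  refine ⟨fun h => ?_, fun hq => ?_⟩
  -- Coprime degrees give connectedness by counting; coprime local orders give it from X through the
  -- homeomorphism.
  · have hconn : ConnectedSpace D.Normalization := by
      rcases h with h | h
      · have := D.preconnectedSpace_of_coprime hol₁.continuous hol₂.continuous h
        exact ⟨hne⟩
      · obtain ⟨e, -⟩ := hhomeo h
        exact e.symm.surjective.connectedSpace e.symm.continuous
    exact ⟨D.Normalization, inferInstance, inferInstance, D.toPullback,
      { closedRiemannSurface := {}
        isQuotientMap := hquot
        finite_fiber := D.finite_fiber
        finite_identified := D.finite_identified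
        holomorphic_fst := D.mdifferentiable_fst
        holomorphic_snd := D.mdifferentiable_snd }⟩
  · obtain ⟨e, he⟩ := hhomeo hq
    let : ChartedSpace ℂ (Function.Pullback β₁ β₂) := e.transportChartedSpace
    have : HasGroupoid (Function.Pullback β₁ β₂) (contDiffGroupoid ω 𝓘(ℂ)) := e.hasGroupoid_transport _
    have : IsManifold 𝓘(ℂ) ω (Function.Pullback β₁ β₂) := IsManifold.mk' _ _ _
    have hsymm : MDifferentiable 𝓘(ℂ) 𝓘(ℂ) e.symm := e.mdifferentiable_symm_transport
    refine ⟨e.transportChartedSpace, {}, ?_, ?_⟩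
    · have : Function.Pullback.fst = (fun y => (D.toPullback y).fst) ∘ e.symm := by
        ext x
        rw [Function.comp_apply, ← he, e.apply_symm_apply]
      rw [this]
      exact D.mdifferentiable_fst.comp hsymm
    · have : Function.Pullback.snd = (fun y => (D.toPullback y).snd) ∘ e.symm := by
        ext x
        rw [Function.comp_apply, ← he, e.apply_symm_apply]
      rw [this]
      exact D.mdifferentiable_snd.comp hsymm
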